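/- Let $\Lambda=\mathbb C[\mathbf p_1,\mathbf p_2,\dots]$ be the algebra of symmetric functions, graded by $\deg\mathbf p_k=k$. For sequences $x=(x_1,x_2,\dots)$, $y=(y_1,y_2,\dots)$ of complex numbers with finitely many nonzero terms, the value $F(x;y)$ of $F\in\Lambda$ is obtained by substituting $\mathbf p_k\mapsto\sum_i x_i^k+(-1)^{k-1}\sum_i y_i^k$. Let $H(u)=1+\sum_{k\ge1}h_ku^{-k}=\exp\bigl(\sum_{k\ge1}\mathbf p_k\,u^{-k}/k\bigr)$, with $h_0=1$ and $h_k=0$ for $k<0$, and let $s_\mu=\det[h_{\mu_i-i+j}]_{1\le i,j\le\ell(\mu)}$ be the Schur function of a Young diagram $\mu$, where $\ell(\mu)$ is the number of nonzero rows of $\mu$ and $s_\varnothing=1$. Let $a=(a_i)_{i\in\mathbb Z}$ be a sequence of complex numbers, and put $\widehat a_i=-a_{1-i}$ and $(\tau^ra)_i=a_{i+r}$. Define $h_{k;a}\in\Lambda$ by $$1+\sum_{k\ge1}\frac{h_{k;a}}{(u-a_1)\cdots(u-a_k)}=H(u)$$ (an identity of formal series in $u^{-1}$), with $h_{0;a}=1$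 and $h_{k;a}=0$ for $k<0$, and let $$s_{\mu;a}=\det[h_{\mu_i-i+j;\,\tau^{1-j}a}]_{1\le i,j\le\ell(\mu)}$$ be the multiparameter Schur function (again $s_{\varnothing;a}=1$). For a Young diagram $\lambda$ with $D$ diagonal squares, let $P_i=\lambda_i-i$ and $Q_i=\lambda'_i-i$ ($1\le i\le D$) be its Frobenius coordinates, where $\lambda'$ is the transposed diagram, and put $x(\lambda)_i=a_{P_i+1}$, $y(\lambda)_i=\widehat a_{Q_i+1}$ for $1\le i\le D$ and $x(\lambda)_i=y(\lambda)_i=0$ for $i>D$. Let $|\lambda|$ denote the number of squares of $\lambda$. **Theorem.** Assume that the numbers $a_i$, $i\in\mathbb Z$, are pairwise distinct, and let $\mu$ be an arbitrary Young diagram. (I) $s_{\mu;a}$ is the unique element $F\in\Lambda$ such that the top degree homogeneous component of $F$ is $s_\mu$ and $F(x(\lambda);y(\lambda))=0$ for all Young diagrams $\lambda\ne\mu$ with $|\lambda|\le|\mu|$. (II) $s_{\mu;a}$ is also the unique element $F\in\Lambda$ such that $\deg F\le|\mu|$, $$F(x(\mu);y(\mu))=\prod_{(i,j)\in\mu}\bigl(a_{\mu_i-i+1}-a_{j-\mu'_j}\bigr),$$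 and $F(x(\lambda);y(\lambda))=0$ for all Young diagrams $\lambda\ne\mu$ with $|\lambda|\le|\mu|$. -/

import Mathlib

noncomputable section

namespace MultiSchur

/-- The algebra `Λ` of symmetric functions over `ℂ`: polynomials in the power sums
`𝐩₁, 𝐩₂, …`, the variable of index `k` being `𝐩_{k+1}`. -/
abbrev SymFun : Type := MvPolynomial ℕ ℂ

/-- The grading of `Λ`: `𝐩_{k+1}` has degree `k + 1`. -/
def weight (k : ℕ) : ℕ := k + 1

/-- The degree of a symmetric function, with respect to the grading `weight`
(the degree of `0` is `0`). -/
def degree (F : SymFun) : ℕ := MvPolynomial.weightedTotalDegree weight F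

/-- The top degree homogeneous component of a symmetric function. -/
def topComponent (F : SymFun) : SymFun :=
  MvPolynomial.weightedHomogeneousComponent weight (degree F) F

/-- The super realization of `Λ`, evaluated at complex values of the variables
`x = (x₁, x₂, …)`, `y = (y₁, y₂, …)` of which only finitely many are nonzero:
`𝐩_k ↦ ∑ x_i ^ k + (-1) ^ (k - 1) ∑ y_i ^ k`, for `k ≥ 1`. -/
def superEval (x y : ℕ →₀ ℂ) : SymFun →ₐ[ℂ] ℂ :=
  MvPolynomial.aeval fun k : ℕ =>
    (x.sum fun _ v => v ^ (k + 1)) + (-1) ^ k * (y.sum fun _ v => v ^ (k + 1))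

/-- The series `∑_{k ≥ 1} 𝐩_k t ^ k / k`. -/
def powerSumSeries : PowerSeries SymFun :=
  PowerSeries.mk fun n : ℕ =>
    match n with
    | 0 => 0
    | k + 1 => ((k + 1 : ℂ)⁻¹) • (MvPolynomial.X k : SymFun)

/-- The constant term of `powerSumSeries` vanishes, so it may be substituted into `exp`. -/
theorem hasSubst_powerSumSeries : PowerSeries.HasSubst powerSumSeries := by
  apply PowerSeries.HasSubst.of_constantCoeff_zero'
  rw [← PowerSeries.coeff_zero_eq_constantCoeff_apply, powerSumSeries, PowerSeries.coeff_mk]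

/-- The generating series `H = 1 + ∑_{k ≥ 1} h_k t ^ k = exp (∑_{k ≥ 1} 𝐩_k t ^ k / k)` of the
complete homogeneous symmetric functions, where `t = 1 / u`. -/
def H : PowerSeries SymFun :=
  (PowerSeries.exp SymFun).subst powerSumSeries

/-- The complete homogeneous symmetric function `h_n` (with `h_0 = 1`). -/
def h (n : ℕ) : SymFun := PowerSeries.coeff n H

/-- The formal series `1 / ((u - a_1) ⋯ (u - a_k))`, written in `t = 1 / u`, that is
`t ^ k / ((1 - a_1 t) ⋯ (1 - a_k t))`. -/
def basisSeries (a : ℤ → ℂ) (k : ℕ) : PowerSeries ℂ :=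
  PowerSeries.X ^ k *
    ∏ i ∈ Finset.range k, (1 - PowerSeries.C (a ((i : ℤ) + 1)) * PowerSeries.X)⁻¹

/-- The functions `h_{n;a}`, determined by the expansion
`1 + ∑_{k ≥ 1} h_{k;a} / ((u - a_1) ⋯ (u - a_k)) = H(u)`. The recursion is the comparison of the
coefficients of `u ^ (-n)` on both sides (see `coeff_H_eq_sum`). -/
def hMulti (a : ℤ → ℂ) (n : ℕ) : SymFun :=
  h n - ∑ k : Fin n, PowerSeries.coeff n (basisSeries a k) • hMulti a k
termination_by n

/-- The lowest coefficient of `basisSeries a n` is `1`. -/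
theorem coeff_basisSeries_self (a : ℤ → ℂ) (n : ℕ) :
    PowerSeries.coeff n (basisSeries a n) = 1 := by
  have := PowerSeries.coeff_X_pow_mul
    (∏ i ∈ Finset.range n, (1 - PowerSeries.C (a ((i : ℤ) + 1)) * PowerSeries.X)⁻¹ :
      PowerSeries ℂ) n 0
  rw [zero_add] at this
  rw [basisSeries, this, PowerSeries.coeff_zero_eq_constantCoeff_apply, map_prod]
  simp

/-- `basisSeries a k` starts in degree `k`. -/
theorem coeff_basisSeries_of_lt (a : ℤ → ℂ) {n k : ℕ} (hnk : n < k) :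
    PowerSeries.coeff n (basisSeries a k) = 0 := by
  rw [basisSeries, PowerSeries.coeff_X_pow_mul', if_neg (not_le.mpr hnk)]

/-- The defining generating series of the functions `h_{k;a}`, coefficient by coefficient
(the terms with `k > n` do not contribute to the coefficient of `t ^ n`). -/
theorem coeff_H_eq_sum (a : ℤ → ℂ) (n : ℕ) :
    PowerSeries.coeff n H =
      ∑ k ∈ Finset.range (n + 1), PowerSeries.coeff n (basisSeries a k) • hMulti a k := by
  rw [Finset.sum_range_succ, coeff_basisSeries_self, one_smul]
  conv_rhs => rw [hMulti]
  rw [Finset.sum_range fun k => PowerSeries.coeff n (basisSeries a k) • hMulti a k, h]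
  abel

/-- The sequence `(f_n)` extended to integer indices by `0` for `n < 0`. -/
def extendByZero (f : ℕ → SymFun) : ℤ → SymFun
  | Int.ofNat n => f n
  | Int.negSucc _ => 0

/-- The shift `(τ ^ r a)_i = a_{i + r}`. -/
def shift (r : ℤ) (a : ℤ → ℂ) : ℤ → ℂ := fun i => a (i + r)

/-- The dual sequence `â_i = -a_{1 - i}`. -/
def dual (a : ℤ → ℂ) : ℤ → ℂ := fun i => -a (1 - i)

/-- The number `ℓ(μ)` of nonzero rows. -/
def length (μ : YoungDiagram) : ℕ := μ.colLen 0

/-- The Jacobi--Trudi determinant `det [h_{μ_i - i + j}]` of order `n`. Rows and columns are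
numbered from `0`, which does not affect the difference `j - i`. -/
def schurDet (n : ℕ) (μ : YoungDiagram) : SymFun :=
  Matrix.det (Matrix.of fun i j : Fin n =>
    extendByZero h ((μ.rowLen i : ℤ) - (i : ℤ) + (j : ℤ)))

/-- The determinant `det [h_{μ_i - i + j; τ ^ (1 - j) a}]` of order `n`. Rows and columns are
numbered from `0`, so that `1 - j` becomes `-j`. -/
def multiSchurDet (n : ℕ) (a : ℤ → ℂ) (μ : YoungDiagram) : SymFun :=
  Matrix.det (Matrix.of fun i j : Fin n =>
    extendByZero (hMulti (shift (-(j : ℤ)) a)) ((μ.rowLen i : ℤ) - (i : ℤ) + (j : ℤ)))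

/-- The Schur function `s_μ`. -/
def schur (μ : YoungDiagram) : SymFun := schurDet (length μ) μ

/-- The multiparameter Schur function `s_{μ;a}`. -/
def multiSchur (a : ℤ → ℂ) (μ : YoungDiagram) : SymFun := multiSchurDet (length μ) a μ

/-- A determinant of Jacobi--Trudi type does not depend on its order `n ≥ ℓ(μ)`. -/
theorem det_stable (g : ℤ → ℕ → SymFun) (hneg : ∀ k j, k < 0 → g k j = 0) (h0 : ∀ j, g 0 j = 1)
    (μ : YoungDiagram) {n : ℕ} (hn : length μ ≤ n) :
    Matrix.det (Matrix.of fun i j : Fin n => g ((μ.rowLen i : ℤ) - (i : ℤ) + (j : ℤ)) j) =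
    Matrix.det (Matrix.of fun i j : Fin (length μ) =>
      g ((μ.rowLen i : ℤ) - (i : ℤ) + (j : ℤ)) j) := by
  induction n, hn using Nat.le_induction with
  | base => rfl
  | succ n hn ih =>
    rw [← ih]
    have hr : μ.rowLen n = 0 := by
      by_contra hne
      have h1 : (n, 0) ∈ μ := YoungDiagram.mem_iff_lt_rowLen.mpr (Nat.pos_of_ne_zero hne)
      have h2 := YoungDiagram.mem_iff_lt_colLen.mp h1
      exact absurd h2 (not_lt.mpr hn)
    rw [Matrix.det_succ_row _ (Fin.last n), Fin.sum_univ_castSucc, Finset.sum_eq_zero, zero_add]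
    · simp only [Matrix.of_apply, Fin.val_last, hr, Fin.succAbove_last]
      rw [show ((0 : ℕ) : ℤ) - (n : ℤ) + (n : ℤ) = 0 by ring, h0, Even.neg_one_pow ⟨n, rfl⟩]
      simp only [one_mul]
      rfl
    · intro j _
      simp only [Matrix.of_apply, Fin.val_last, hr, Fin.val_castSucc]
      rw [hneg _ _ (by have := j.isLt; omega)]
      simp

/-- `h_0 = 1`. -/
theorem coeff_zero_H : PowerSeries.coeff 0 H = 1 := by
  have h1 := hasSubst_powerSumSeries
  rw [H, PowerSeries.coeff_subst' h1, finsum_eq_single _ 0]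
  · simp
  · intro n hn
    rw [PowerSeries.coeff_zero_eq_constantCoeff_apply, map_pow,
      ← PowerSeries.coeff_zero_eq_constantCoeff_apply, powerSumSeries, PowerSeries.coeff_mk]
    simp [hn]

/-- `h_{0;a} = 1`. -/
theorem hMulti_zero (a : ℤ → ℂ) : hMulti a 0 = 1 := by
  rw [hMulti]; simp [h, coeff_zero_H]

/-- Any order `n ≥ ℓ(μ)` may be used in the definition of `s_μ`. -/
theorem schurDet_eq_schur (μ : YoungDiagram) {n : ℕ} (hn : length μ ≤ n) :
    schurDet n μ = schur μ :=
  det_stable (fun k _ => extendByZero h k)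
    (fun k _ hk => by cases k with
      | ofNat m => exact absurd hk (not_lt.mpr (Int.natCast_nonneg m))
      | negSucc m => rfl)
    (fun _ => coeff_zero_H) μ hn

/-- Any order `n ≥ ℓ(μ)` may be used in the definition of `s_{μ;a}`. -/
theorem multiSchurDet_eq_multiSchur (a : ℤ → ℂ) (μ : YoungDiagram) {n : ℕ}
    (hn : length μ ≤ n) : multiSchurDet n a μ = multiSchur a μ :=
  det_stable (fun k j => extendByZero (hMulti (shift (-(j : ℤ)) a)) k)
    (fun k _ hk => by cases k with
      | ofNat m => exact absurd hk (not_lt.mpr (Int.natCast_nonneg m))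
      | negSucc m => rfl)
    (fun _ => hMulti_zero _) μ hn

/-- The depth of a diagram: the number of its diagonal squares. -/
def depth (μ : YoungDiagram) : ℕ := (μ.cells.filter fun c => c.1 = c.2).card

/-- The Frobenius coordinate `p_{i+1} = μ_{i+1} - (i + 1)`, for `i < depth μ`. -/
def frobP (μ : YoungDiagram) (i : ℕ) : ℤ := (μ.rowLen i : ℤ) - ((i : ℤ) + 1)

/-- The Frobenius coordinate `q_{i+1} = μ'_{i+1} - (i + 1)`, for `i < depth μ`. -/
def frobQ (μ : YoungDiagram) (i : ℕ) : ℤ := (μ.colLen i : ℤ) - ((i : ℤ) + 1)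

/-- The sequence equal to `f i` for `i < d` and to `0` for `i ≥ d`. -/
def truncSeq (d : ℕ) (f : ℕ → ℂ) : ℕ →₀ ℂ :=
  Finsupp.onFinset (Finset.range d) (fun i => if i < d then f i else 0) (by
    intro i hi
    by_contra hd
    exact hi (if_neg fun hlt => hd (Finset.mem_range.mpr hlt)))

/-- The variables `x(λ)`: `x(λ)_i = a_{P_i + 1}` for `i ≤ D` and `0` for `i > D`, where `D` is
the depth of `λ`. -/
def xCoord (a : ℤ → ℂ) (lam : YoungDiagram) : ℕ →₀ ℂ :=
  truncSeq (depth lam) fun i => a (frobP lam i + 1)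

/-- The variables `y(λ)`: `y(λ)_i = â_{Q_i + 1}` for `i ≤ D` and `0` for `i > D`, where `D` is
the depth of `λ`. -/
def yCoord (a : ℤ → ℂ) (lam : YoungDiagram) : ℕ →₀ ℂ :=
  truncSeq (depth lam) fun i => dual a (frobQ lam i + 1)

/-- The value `F(x(λ); y(λ))`. -/
def valueAt (a : ℤ → ℂ) (lam : YoungDiagram) (F : SymFun) : ℂ :=
  superEval (xCoord a lam) (yCoord a lam) F

/-- The set `D(μ)` of the diagrams `λ ≠ μ` with `|λ| ≤ |μ|`. -/
def lowerDiagrams (μ : YoungDiagram) : Set YoungDiagram :=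
  {lam | lam.card ≤ μ.card ∧ lam ≠ μ}

/-- The product `∏_{(i,j) ∈ μ} (a_{μ_i - i + 1} - a_{j - μ'_j})`; the squares of a
`YoungDiagram` are numbered from `(0, 0)`. -/
def hookProduct (a : ℤ → ℂ) (μ : YoungDiagram) : ℂ :=
  ∏ c ∈ μ.cells,
    (a ((μ.rowLen c.1 : ℤ) - (c.1 : ℤ)) - a ((c.2 : ℤ) + 1 - (μ.colLen c.2 : ℤ)))

end MultiSchur

end

noncomputable section

namespace MultiSchur

/-! Number rows and columns from 0 and let `n ≥ ℓ(λ)`. Reading the boundary of `λ` turns Frobenius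
coordinates into row lengths: `𝐩_k` takes at `λ` the value `∑_{i<n} a_{λ_i-i}^k - ∑_{i<n} a_{-i}^k`,
so `H` becomes `∏ (1 - a_{-i} t) / ∏ (1 - z_i t)` with distinct nodes `z_i = a_{λ_i-i}`. Partial
fractions, and the expansion of `1/(u - z)` in the series `1/((u - b_1)⋯(u - b_{k+1}))`, express the
values of `h_{k;b}` as sums over the nodes. The Jacobi–Trudi matrix of `s_{μ;a}` at `λ` then factors
as (products `∏_{m<r} (x - a_{1-n+m})`, `r = μ_i+n-1-i`, at the nodes) · (diagonal) · (monic
polynomials of degree `j` at the nodes). The last factor has a Vandermonde determinant, which gives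
the ratio of determinants `valueAt_multiSchur`.

The entry `(i, l)` of the numerator vanishes when `λ_l - l < μ_i - i`. If `μ ⊄ λ`, this produces a
zero block meeting the diagonal, so the value is 0. If `λ = μ`, the matrix is triangular and its
diagonal product is the denominator times the hook product.

Hence the values of the `s_{ν;a}` at the diagrams with at most `N` squares form a triangular array
with nonzero diagonal, and evaluation maps the functions of degree at most `N` onto all functions on
these diagrams. Monomials in the `𝐩_k` of degree at most `N` are indexed by the same diagrams, so
evaluation is also injective (`eq_zero_of_valueAt_eq_zero`). This gives (II) with `N = |μ|`. For
(I), `s_{μ;a} - s_μ` has lower degree, so two candidates differ by a function of degree less than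
`|μ|` that vanishes at all smaller diagrams. -/

/-! ### Combinatorics of diagrams: boundary contents, Frobenius coordinates, hooks -/

open Finset in
/-- The contents read along the boundary path of a diagram, from row `n` of column `0` to the
corner `(l, k)`: every integer of `[1 - n, k - l]` is either `μ_i - i` for a row `i ≥ l` or
`j + 1 - μ'_j` for a column `j < k` (rows and columns are numbered from `0`). -/
theorem prod_Ico_eq_prod_rows_mul_prod_cols {M : Type*} [CommMonoid M] (μ : YoungDiagram)
    {l k n : ℕ} (hn : length μ ≤ n) (hl : l ≤ n) (hr : μ.rowLen l ≤ k)
    (hc : ∀ j < k, l ≤ μ.colLen j) (f : ℤ → M) :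
    ∏ m ∈ Ico (1 - n : ℤ) (k - l + 1), f m =
      (∏ i ∈ Ico l n, f (μ.rowLen i - i)) * ∏ j ∈ range k, f (j + 1 - μ.colLen j) := by
  have hrow : Set.InjOn (fun i : ℕ => (μ.rowLen i : ℤ) - i) (Ico l n) := by
    intro i _ i' _ h
    rcases lt_trichotomy i i' with hlt | heq | hlt
    · have := μ.rowLen_anti _ _ hlt.le
      simp only at h; omega
    · exact heq
    · have := μ.rowLen_anti _ _ hlt.le
      simp only at h; omega
  have hcol : Set.InjOn (fun j : ℕ => (j : ℤ) + 1 - μ.colLen j) (range k) := by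
    intro i _ i' _ h
    rcases lt_trichotomy i i' with hlt | heq | hlt
    · have := μ.colLen_anti _ _ hlt.le
      simp only at h; omega
    · exact heq
    · have := μ.colLen_anti _ _ hlt.le
      simp only at h; omega
  have hdisj : Disjoint ((Ico l n).image fun i : ℕ => (μ.rowLen i : ℤ) - i)
      ((range k).image fun j : ℕ => (j : ℤ) + 1 - μ.colLen j) := by
    rw [disjoint_left]
    simp only [mem_image, not_exists, not_and]
    rintro _ ⟨i, -, rfl⟩ j - h
    by_cases hij : (i, j) ∈ μ
    · have h1 := YoungDiagram.mem_iff_lt_rowLen.mp hij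
      have h2 := YoungDiagram.mem_iff_lt_colLen.mp hij
      omega
    · have h1 := mt YoungDiagram.mem_iff_lt_rowLen.mpr hij
      have h2 := mt YoungDiagram.mem_iff_lt_colLen.mpr hij
      omega
  rw [← prod_image (f := f) hrow, ← prod_image (f := f) hcol, ← prod_union hdisj]
  -- The two disjoint families lie in the interval and have `(n - l) + k` members in all, which is
  -- its length.
  refine prod_congr (Eq.symm (eq_of_subset_of_card_le ?_ ?_)) fun _ _ => rfl
  · intro m hm
    rw [length] at hn
    simp only [mem_union, mem_image, mem_Ico, mem_range] at hm ⊢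
    rcases hm with ⟨i, ⟨h1, h2⟩, rfl⟩ | ⟨j, hj, rfl⟩
    · have := μ.rowLen_anti _ _ h1
      omega
    · have h1 := hc j hj
      have h2 := μ.colLen_anti _ _ (Nat.zero_le j)
      omega
  · rw [card_union_of_disjoint hdisj, card_image_of_injOn hrow, card_image_of_injOn hcol]
    simp only [Int.card_Ico, Nat.card_Ico, card_range]
    omega

/-- The diagonal squares form an initial segment of the diagonal, so counting them locates its end.
-/
theorem lt_depth_iff (μ : YoungDiagram) (i : ℕ) : i < depth μ ↔ (i, i) ∈ μ := by
  have hlow : ∃ d, ∀ i, i < d ↔ (i, i) ∈ μ := by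
    have hex : ∃ d, (d, d) ∉ μ := by
      refine ⟨μ.colLen 0, fun h => ?_⟩
      have h1 := YoungDiagram.mem_iff_lt_colLen.mp h
      have h2 := μ.colLen_anti _ _ (Nat.zero_le (μ.colLen 0))
      omega
    classical
    refine ⟨Nat.find hex, fun i => ⟨fun h => ?_, fun h => ?_⟩⟩
    · simpa using Nat.find_min hex h
    · by_contra hle
      exact Nat.find_spec hex (μ.up_left_mem (not_lt.mp hle) (not_lt.mp hle) h)
  obtain ⟨d, hd⟩ := hlow
  have hcard : depth μ = d := by
    rw [depth, ← Finset.card_range d, ← Finset.card_image_of_injective (Finset.range d)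
      (f := fun i => (i, i)) (fun i j h => (Prod.ext_iff.mp h).1)]
    congr 1
    ext ⟨i, j⟩
    simp only [Finset.mem_filter, YoungDiagram.mem_cells, Finset.mem_image, Finset.mem_range,
      Prod.mk.injEq]
    constructor
    · rintro ⟨h, rfl⟩
      exact ⟨i, (hd i).mpr h, rfl, rfl⟩
    · rintro ⟨i, h, rfl, rfl⟩
      exact ⟨(hd i).mp h, rfl⟩
  rw [hcard, hd]

theorem rowLen_depth_le (μ : YoungDiagram) : μ.rowLen (depth μ) ≤ depth μ := by
  by_contra! h
  exact lt_irrefl _ ((lt_depth_iff μ _).mpr (YoungDiagram.mem_iff_lt_rowLen.mpr h))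

theorem depth_le_colLen (μ : YoungDiagram) {j : ℕ} (hj : j < depth μ) :
    depth μ ≤ μ.colLen j := by
  have h1 := (lt_depth_iff μ (depth μ - 1)).mp (by omega)
  have h2 := YoungDiagram.mem_iff_lt_colLen.mp
    (μ.up_left_mem le_rfl (show j ≤ depth μ - 1 by omega) h1)
  omega

theorem depth_le_length (μ : YoungDiagram) : depth μ ≤ length μ := by
  rcases Nat.eq_zero_or_pos (depth μ) with h | h
  · omega
  · exact depth_le_colLen μ h

theorem rowLen_eq_zero {μ : YoungDiagram} {i : ℕ} (hi : length μ ≤ i) : μ.rowLen i = 0 := by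
  by_contra hne
  exact absurd (YoungDiagram.mem_iff_lt_colLen.mp
    (YoungDiagram.mem_iff_lt_rowLen.mpr (Nat.pos_of_ne_zero hne))) (not_lt.mpr hi)

/-- The passage from the Frobenius coordinates to the modified row lengths. -/
theorem sum_frob_eq_sum_rows {M : Type*} [AddCommGroup M] (μ : YoungDiagram) {n : ℕ}
    (hn : length μ ≤ n) (f : ℤ → M) :
    ∑ i ∈ Finset.range (depth μ), f (frobP μ i + 1) -
        ∑ i ∈ Finset.range (depth μ), f (-frobQ μ i) =
      ∑ i ∈ Finset.range n, f (μ.rowLen i - i) - ∑ i ∈ Finset.range n, f (-i) := by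
  have hd := (depth_le_length μ).trans hn
  -- With `l = k = depth μ` the interval is `[1 - n, 0]`, that is, the numbers `-i` for `i < n`.
  have key := prod_Ico_eq_prod_rows_mul_prod_cols (M := Multiplicative M) μ hn hd
    (rowLen_depth_le μ) (fun j => depth_le_colLen μ) (fun m => Multiplicative.ofAdd (f m))
  simp only [← ofAdd_sum, ← ofAdd_add, Multiplicative.ofAdd.apply_eq_iff_eq] at key
  have hI : ∑ i ∈ Finset.range n, f (-i) = ∑ m ∈ Finset.Ico (1 - n : ℤ) (depth μ - depth μ + 1),
      f m := by
    refine Finset.sum_bij (fun i _ => -(i : ℤ)) ?_ ?_ ?_ fun _ _ => rfl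
    · intro i hi
      simp only [Finset.mem_range, Finset.mem_Ico] at hi ⊢
      omega
    · intro i _ j _ h
      simpa using h
    · intro m hm
      simp only [Finset.mem_range, Finset.mem_Ico] at hm ⊢
      exact ⟨(-m).toNat, by omega, by omega⟩
  rw [hI, key, ← Finset.sum_range_add_sum_Ico _ hd]
  simp only [frobP, frobQ, sub_add_eq_sub_sub, neg_sub]
  have h1 : ∀ i ∈ Finset.range (depth μ), f ((μ.rowLen i : ℤ) - i - 1 + 1) =
      f (μ.rowLen i - i) := fun i _ => by rw [sub_add_cancel]
  have h2 : ∀ i ∈ Finset.range (depth μ), f (1 - ((μ.colLen i : ℤ) - i)) =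
      f (i + 1 - μ.colLen i) := fun i _ => by congr 1; ring
  rw [Finset.sum_congr rfl h1, Finset.sum_congr rfl h2]
  abel

/-- The product of hook differences along one row. -/
theorem prod_row_mul_prod_below {M : Type*} [CommMonoid M] (μ : YoungDiagram) {i n : ℕ}
    (hn : length μ ≤ n) (hi : i < n) (f : ℤ → M) :
    ∏ m ∈ Finset.range (μ.rowLen i + n - 1 - i), f (1 - n + m) =
      (∏ l ∈ Finset.Ico (i + 1) n, f (μ.rowLen l - l)) *
        ∏ j ∈ Finset.range (μ.rowLen i), f (j + 1 - μ.colLen j) := by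
  rw [← prod_Ico_eq_prod_rows_mul_prod_cols μ hn (Nat.succ_le_of_lt hi)
    (μ.rowLen_anti _ _ (Nat.le_succ i))
    fun j hj => YoungDiagram.mem_iff_lt_colLen.mp (YoungDiagram.mem_iff_lt_rowLen.mpr hj)]
  refine Finset.prod_bij (fun m _ => 1 - n + m) ?_ ?_ ?_ fun _ _ => rfl
  · intro m hm
    simp only [Finset.mem_range, Finset.mem_Ico] at hm ⊢
    omega
  · intro m _ m' _ h
    simpa using h
  · intro m hm
    simp only [Finset.mem_range, Finset.mem_Ico] at hm ⊢
    exact ⟨(m - (1 - n)).toNat, by omega, by omega⟩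

theorem exists_rowLen_lt_of_not_le {μ lam : YoungDiagram} (h : ¬ μ ≤ lam) :
    ∃ i, lam.rowLen i < μ.rowLen i := by
  by_contra! hle
  refine h fun c hc => ?_
  have h1 : c.2 < μ.rowLen c.1 := YoungDiagram.mem_iff_lt_rowLen.mp hc
  exact YoungDiagram.mem_iff_lt_rowLen.mpr (h1.trans_le (hle _))

theorem eq_of_le_of_card_le {μ lam : YoungDiagram} (h : μ ≤ lam) (hc : lam.card ≤ μ.card) :
    lam = μ :=
  YoungDiagram.ext (Finset.eq_of_subset_of_card_le (YoungDiagram.cells_subset_iff.mpr h) hc).symm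

theorem prod_cells {M : Type*} [CommMonoid M] (μ : YoungDiagram) {n : ℕ} (hn : length μ ≤ n)
    (f : ℕ → ℕ → M) :
    ∏ c ∈ μ.cells, f c.1 c.2 = ∏ i ∈ Finset.range n, ∏ j ∈ Finset.range (μ.rowLen i), f i j := by
  rw [Finset.prod_sigma']
  refine Finset.prod_bij' (fun c _ => ⟨c.1, c.2⟩) (fun c _ => (c.1, c.2)) ?_ ?_
    (fun _ _ => rfl) (fun _ _ => rfl) (fun _ _ => rfl)
  · rintro ⟨i, j⟩ hc
    have h1 := YoungDiagram.mem_iff_lt_rowLen.mp ((μ.mem_cells _).mp hc)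
    simp only [Finset.mem_sigma, Finset.mem_range]
    refine ⟨?_, h1⟩
    by_contra! hi
    rw [rowLen_eq_zero (hn.trans hi)] at h1
    omega
  · rintro ⟨i, j⟩ hc
    simp only [Finset.mem_sigma, Finset.mem_range] at hc
    exact (μ.mem_cells _).mpr (YoungDiagram.mem_iff_lt_rowLen.mpr hc.2)

theorem card_eq_sum_rowLen (μ : YoungDiagram) {n : ℕ} (hn : length μ ≤ n) :
    μ.card = ∑ i ∈ Finset.range n, μ.rowLen i := by
  have h := prod_cells (M := Multiplicative ℕ) μ hn fun _ _ => Multiplicative.ofAdd 1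
  simp only [← ofAdd_sum, Multiplicative.ofAdd.apply_eq_iff_eq] at h
  simpa [YoungDiagram.card] using h

/-- In each factor the two indices differ by the hook length of the square, which is positive. -/
theorem hookProduct_ne_zero {a : ℤ → ℂ} (ha : Function.Injective a) (μ : YoungDiagram) :
    hookProduct a μ ≠ 0 := by
  refine Finset.prod_ne_zero_iff.mpr ?_
  rintro ⟨i, j⟩ hc h
  have h1 := YoungDiagram.mem_iff_lt_rowLen.mp ((μ.mem_cells _).mp hc)
  have h2 := YoungDiagram.mem_iff_lt_colLen.mp ((μ.mem_cells _).mp hc)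
  have := ha (sub_eq_zero.mp h)
  simp only at this
  omega

/-! ### Newton's identities from the logarithmic derivative of `H` -/

open MvPolynomial in
theorem derivative_H :
    PowerSeries.derivative SymFun H = H * PowerSeries.mk fun k => (X k : SymFun) := by
  have hP : PowerSeries.derivative SymFun powerSumSeries = PowerSeries.mk fun k => (X k : SymFun) := by
    ext1 k
    rw [PowerSeries.coeff_derivative, powerSumSeries, PowerSeries.coeff_mk, PowerSeries.coeff_mk]
    have h1 : ((k : SymFun) + 1) = C ((k : ℂ) + 1) := by simp
    have h2 : (k + 1 : ℂ) ≠ 0 := by exact_mod_cast Nat.succ_ne_zero k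
    simp only
    rw [h1, mul_comm, MvPolynomial.C_mul', smul_smul, mul_inv_cancel₀ h2, one_smul]
  rw [H, PowerSeries.derivative_subst hasSubst_powerSumSeries, PowerSeries.derivative_exp, hP]

open MvPolynomial in
/-- Newton's identities. -/
theorem newton (n : ℕ) :
    ((n : SymFun) + 1) * h (n + 1) = ∑ p ∈ Finset.HasAntidiagonal.antidiagonal n, h p.1 * X p.2 := by
  have h1 := congrArg (PowerSeries.coeff n) derivative_H
  rw [PowerSeries.coeff_derivative, PowerSeries.coeff_mul] at h1
  simp only [PowerSeries.coeff_mk] at h1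
  rw [mul_comm]
  exact h1

/-! ### Degrees and leading parts -/

/-- The weighted degree of a monomial. -/
def monomialDegree (m : ℕ →₀ ℕ) : ℕ := Finsupp.weight weight m

theorem monomialDegree_add (m m' : ℕ →₀ ℕ) :
    monomialDegree (m + m') = monomialDegree m + monomialDegree m' :=
  map_add _ _ _

/-- The symmetric functions all of whose monomials have degree less than `d`. -/
def degLT (d : ℤ) : Submodule ℂ SymFun where
  carrier := {F | ∀ m, MvPolynomial.coeff m F ≠ 0 → (monomialDegree m : ℤ) < d}
  zero_mem' m hm := absurd (MvPolynomial.coeff_zero m) hm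
  add_mem' {F G} hF hG m hm := by
    by_contra hd
    refine hm ?_
    rw [MvPolynomial.coeff_add, not_not.mp (mt (hF m) hd), not_not.mp (mt (hG m) hd), add_zero]
  smul_mem' c F hF m hm := hF m (right_ne_zero_of_mul (by simpa using hm))

theorem degLT_mono {d e : ℤ} (hde : d ≤ e) : degLT d ≤ degLT e :=
  fun _ hF m hm => (hF m hm).trans_le hde

theorem exists_of_coeff_mul_ne_zero {F G : SymFun} {m : ℕ →₀ ℕ}
    (hm : MvPolynomial.coeff m (F * G) ≠ 0) :
    ∃ p q, p + q = m ∧ MvPolynomial.coeff p F ≠ 0 ∧ MvPolynomial.coeff q G ≠ 0 := by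
  classical
  rw [MvPolynomial.coeff_mul] at hm
  obtain ⟨⟨p, q⟩, hpq, hne⟩ := Finset.exists_ne_zero_of_sum_ne_zero hm
  exact ⟨p, q, Finset.HasAntidiagonal.mem_antidiagonal.mp hpq, left_ne_zero_of_mul hne, right_ne_zero_of_mul hne⟩

/-- `f` is homogeneous of degree `d`, and `F` differs from `f` by terms of lower degree. -/
def HasLeadingPart (d : ℤ) (F f : SymFun) : Prop :=
  (∀ m, MvPolynomial.coeff m f ≠ 0 → (monomialDegree m : ℤ) = d) ∧ F - f ∈ degLT d

namespace HasLeadingPart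

variable {d e : ℤ} {F G f g : SymFun}

theorem mem_degLT_succ (hF : HasLeadingPart d F f) : F ∈ degLT (d + 1) := by
  rw [← sub_add_cancel F f]
  refine add_mem (degLT_mono (by omega) hF.2) fun m hm => ?_
  rw [hF.1 m hm]
  omega

/-- Zero counts as homogeneous of every degree, negative ones included; this covers the entries
`h_k` with `k < 0`. -/
theorem zero : HasLeadingPart d 0 0 :=
  ⟨fun m hm => absurd (MvPolynomial.coeff_zero m) hm, by simp⟩

theorem one : HasLeadingPart 0 1 1 := by
  classical
  refine ⟨fun m hm => ?_, by simp⟩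
  rw [MvPolynomial.coeff_one] at hm
  rw [← (ite_ne_right_iff.mp hm).1, monomialDegree, map_zero, Nat.cast_zero]

theorem add (hF : HasLeadingPart d F f) (hG : HasLeadingPart d G g) :
    HasLeadingPart d (F + G) (f + g) := by
  refine ⟨fun m hm => ?_, ?_⟩
  · by_contra hd
    refine hm ?_
    rw [MvPolynomial.coeff_add, not_not.mp (mt (hF.1 m) hd), not_not.mp (mt (hG.1 m) hd), add_zero]
  · rw [add_sub_add_comm]
    exact add_mem hF.2 hG.2

theorem smul (c : ℂ) (hF : HasLeadingPart d F f) : HasLeadingPart d (c • F) (c • f) := by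
  refine ⟨fun m hm => hF.1 m (right_ne_zero_of_mul (by simpa using hm)), ?_⟩
  rw [← smul_sub]
  exact Submodule.smul_mem _ _ hF.2

theorem mul (hF : HasLeadingPart d F f) (hG : HasLeadingPart e G g) :
    HasLeadingPart (d + e) (F * G) (f * g) := by
  refine ⟨fun m hm => ?_, ?_⟩
  · obtain ⟨p, q, rfl, hp, hq⟩ := exists_of_coeff_mul_ne_zero hm
    rw [monomialDegree_add, Nat.cast_add, hF.1 p hp, hG.1 q hq]
  · rw [show F * G - f * g = (F - f) * G + f * (G - g) by ring]
    refine add_mem (fun m hm => ?_) fun m hm => ?_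
    · obtain ⟨p, q, rfl, hp, hq⟩ := exists_of_coeff_mul_ne_zero hm
      have h1 := hF.2 p hp
      have h2 := hG.mem_degLT_succ q hq
      rw [monomialDegree_add]
      push_cast
      omega
    · obtain ⟨p, q, rfl, hp, hq⟩ := exists_of_coeff_mul_ne_zero hm
      have h1 := hF.1 p hp
      have h2 := hG.2 q hq
      rw [monomialDegree_add]
      push_cast
      omega

theorem sum {ι : Type*} (s : Finset ι) {F f : ι → SymFun}
    (hF : ∀ i ∈ s, HasLeadingPart d (F i) (f i)) :
    HasLeadingPart d (∑ i ∈ s, F i) (∑ i ∈ s, f i) := by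
  classical
  induction s using Finset.induction_on with
  | empty => simpa using zero
  | insert i s hi ih =>
    rw [Finset.sum_insert hi, Finset.sum_insert hi]
    exact (hF i (Finset.mem_insert_self _ _)).add
      (ih fun j hj => hF j (Finset.mem_insert_of_mem hj))

theorem prod {ι : Type*} (s : Finset ι) {F f : ι → SymFun} {d : ι → ℤ}
    (hF : ∀ i ∈ s, HasLeadingPart (d i) (F i) (f i)) :
    HasLeadingPart (∑ i ∈ s, d i) (∏ i ∈ s, F i) (∏ i ∈ s, f i) := by
  classical
  induction s using Finset.induction_on with
  | empty => simpa using one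
  | insert i s hi ih =>
    rw [Finset.sum_insert hi, Finset.prod_insert hi, Finset.prod_insert hi]
    exact (hF i (Finset.mem_insert_self _ _)).mul
      (ih fun j hj => hF j (Finset.mem_insert_of_mem hj))

/-- When degrees split as row part plus column part, all terms of the Leibniz expansion have the
same degree. -/
theorem det {n : ℕ} {A B : Matrix (Fin n) (Fin n) SymFun} {r c : Fin n → ℤ}
    (hAB : ∀ i j, HasLeadingPart (r i + c j) (A i j) (B i j)) :
    HasLeadingPart (∑ i, r i + ∑ j, c j) A.det B.det := by
  rw [Matrix.det_apply', Matrix.det_apply']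
  refine sum _ fun σ _ => ?_
  have h1 := prod (Finset.univ : Finset (Fin n)) fun i _ => hAB (σ i) i
  rw [Finset.sum_add_distrib, Equiv.sum_comp σ r] at h1
  have h2 := h1.smul ((Equiv.Perm.sign σ : ℤ) : ℂ)
  simpa [MvPolynomial.smul_eq_C_mul] using h2

end HasLeadingPart

theorem hasLeadingPart_X (k : ℕ) :
    HasLeadingPart ((k : ℤ) + 1) (MvPolynomial.X k) (MvPolynomial.X k) := by
  classical
  refine ⟨fun m hm => ?_, by simp⟩
  rw [MvPolynomial.coeff_X] at hm
  rw [← (ite_ne_right_iff.mp hm).1, monomialDegree, Finsupp.weight_single]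
  simp [weight]

theorem hasLeadingPart_h (n : ℕ) : HasLeadingPart n (h n) (h n) := by
  induction n using Nat.strong_induction_on with
  | _ n ih =>
    cases n with
    | zero => rw [show h 0 = 1 from coeff_zero_H]; exact HasLeadingPart.one
    | succ n =>
      have h1 : HasLeadingPart ((n : ℤ) + 1) (((n : SymFun) + 1) * h (n + 1))
          (((n : SymFun) + 1) * h (n + 1)) := by
        rw [newton]
        refine HasLeadingPart.sum _ fun p hp => ?_
        have hp' := Finset.HasAntidiagonal.mem_antidiagonal.mp hp
        have h2 := (ih p.1 (by omega)).mul (hasLeadingPart_X p.2)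
        rwa [show (p.1 : ℤ) + ((p.2 : ℤ) + 1) = n + 1 by omega] at h2
      have h2 := h1.smul ((n : ℂ) + 1)⁻¹
      have h3 : ((n : ℂ) + 1) ≠ 0 := by exact_mod_cast Nat.succ_ne_zero n
      have h4 : ((n : ℂ) + 1)⁻¹ • (((n : SymFun) + 1) * h (n + 1)) = h (n + 1) := by
        rw [show ((n : SymFun) + 1) = MvPolynomial.C ((n : ℂ) + 1) by simp, MvPolynomial.C_mul',
          smul_smul, inv_mul_cancel₀ h3, one_smul]
      rw [h4] at h2
      exact_mod_cast h2

theorem hasLeadingPart_hMulti (a : ℤ → ℂ) (n : ℕ) : HasLeadingPart n (hMulti a n) (h n) := by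
  induction n using Nat.strong_induction_on with
  | _ n ih =>
    refine ⟨(hasLeadingPart_h n).1, ?_⟩
    rw [hMulti, sub_sub_cancel_left]
    refine neg_mem (sum_mem fun k _ => Submodule.smul_mem _ _ ?_)
    exact degLT_mono (by have := k.isLt; omega) (ih k k.isLt).mem_degLT_succ

theorem hasLeadingPart_extendByZero (a : ℤ → ℂ) (k : ℤ) :
    HasLeadingPart k (extendByZero (hMulti a) k) (extendByZero h k) := by
  cases k with
  | ofNat n => exact hasLeadingPart_hMulti a n
  | negSucc n => exact HasLeadingPart.zero

theorem hasLeadingPart_multiSchur (a : ℤ → ℂ) (μ : YoungDiagram) :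
    HasLeadingPart μ.card (multiSchur a μ) (schur μ) := by
  have h1 := HasLeadingPart.det (n := length μ)
    (A := Matrix.of fun i j : Fin (length μ) =>
      extendByZero (hMulti (shift (-(j : ℤ)) a)) ((μ.rowLen i : ℤ) - (i : ℤ) + (j : ℤ)))
    (B := Matrix.of fun i j : Fin (length μ) =>
      extendByZero h ((μ.rowLen i : ℤ) - (i : ℤ) + (j : ℤ)))
    (r := fun i => (μ.rowLen i : ℤ) - i) (c := fun j => j)
    fun i j => hasLeadingPart_extendByZero _ _
  -- The row parts `μ_i - i` and column parts `j` add up to `∑ μ_i = |μ|`.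
  rw [Finset.sum_sub_distrib, sub_add_cancel] at h1
  rw [card_eq_sum_rowLen μ le_rfl, Finset.sum_range, Nat.cast_sum]
  exact h1

theorem degree_le_iff {F : SymFun} {d : ℕ} : degree F ≤ d ↔ F ∈ degLT (d + 1) := by
  rw [degree, MvPolynomial.weightedTotalDegree, Finset.sup_le_iff]
  refine forall_congr' fun m => ?_
  rw [MvPolynomial.mem_support_iff]
  refine imp_congr_right fun _ => ?_
  change monomialDegree m ≤ d ↔ _
  omega

theorem coeff_topComponent (F : SymFun) (m : ℕ →₀ ℕ) :
    MvPolynomial.coeff m (topComponent F) =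
      if monomialDegree m = degree F then MvPolynomial.coeff m F else 0 := by
  classical
  rw [topComponent, MvPolynomial.coeff_weightedHomogeneousComponent]
  rfl

theorem hasLeadingPart_topComponent (F : SymFun) :
    HasLeadingPart (degree F) F (topComponent F) := by
  refine ⟨fun m hm => ?_, fun m hm => ?_⟩
  · rw [coeff_topComponent] at hm
    exact_mod_cast (ite_ne_right_iff.mp hm).1
  · rw [MvPolynomial.coeff_sub, coeff_topComponent] at hm
    split_ifs at hm with hd
    · exact absurd (sub_self _) hm
    · rw [sub_zero] at hm
      have := degree_le_iff.mp (le_refl (degree F)) m hm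
      omega

/-- The leading part determines the degree and the top degree component, unless it vanishes. -/
theorem HasLeadingPart.topComponent_eq {d : ℕ} {F f : SymFun} (hF : HasLeadingPart d F f)
    (hf : f ≠ 0) : degree F = d ∧ topComponent F = f := by
  obtain ⟨m, hm⟩ := MvPolynomial.ne_zero_iff.mp hf
  have hcoeff : ∀ m, (monomialDegree m : ℤ) = d →
      MvPolynomial.coeff m F = MvPolynomial.coeff m f := by
    intro m hmd
    have := mt (hF.2 m) (by omega)
    rwa [not_not, MvPolynomial.coeff_sub, sub_eq_zero] at this
  have hdeg : degree F = d := by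
    refine le_antisymm (degree_le_iff.mpr hF.mem_degLT_succ) ?_
    have h1 := degree_le_iff.mp (le_refl (degree F)) m (by rwa [hcoeff m (hF.1 m hm)])
    have h2 := hF.1 m hm
    omega
  refine ⟨hdeg, MvPolynomial.ext _ _ fun m => ?_⟩
  rw [coeff_topComponent, hdeg]
  split_ifs with hmd
  · exact hcoeff m (by exact_mod_cast hmd)
  · by_contra hne
    exact hmd (by exact_mod_cast hF.1 m (Ne.symm hne))

/-! ### The value of `H` at a diagram -/

/-- The series `1 / (1 - z t)`. -/
def geomSeries (z : ℂ) : PowerSeries ℂ := PowerSeries.mk fun n => z ^ n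

theorem one_sub_mul_geomSeries (z : ℂ) :
    (1 - PowerSeries.C z * PowerSeries.X) * geomSeries z = 1 := by
  ext n
  rw [sub_mul, one_mul, mul_assoc, map_sub, PowerSeries.coeff_C_mul, PowerSeries.coeff_one]
  cases n with
  | zero => simp [geomSeries]
  | succ n => simp [geomSeries, PowerSeries.coeff_succ_X_mul, pow_succ, mul_comm]

theorem derivative_prod_one_sub {ι : Type*} (s : Finset ι) (z : ι → ℂ) :
    PowerSeries.derivative ℂ (∏ i ∈ s, (1 - PowerSeries.C (z i) * PowerSeries.X)) =
      -((∏ i ∈ s, (1 - PowerSeries.C (z i) * PowerSeries.X)) *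
        ∑ i ∈ s, PowerSeries.C (z i) * geomSeries (z i)) := by
  classical
  induction s using Finset.induction_on with
  | empty => simp
  | insert i s hi ih =>
    rw [Finset.prod_insert hi, Finset.sum_insert hi, Derivation.leibniz, ih]
    have h1 : PowerSeries.derivative ℂ (1 - PowerSeries.C (z i) * PowerSeries.X) =
        -PowerSeries.C (z i) := by
      rw [map_sub, PowerSeries.derivative_one, Derivation.leibniz, PowerSeries.derivative_C,
        PowerSeries.derivative_X]
      simp
    rw [h1, smul_eq_mul, smul_eq_mul]
    linear_combination ((∏ i ∈ s, (1 - PowerSeries.C (z i) * PowerSeries.X)) *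
      PowerSeries.C (z i)) * one_sub_mul_geomSeries (z i)

/-- A first order linear equation for power series determines the solution from its constant
coefficient. -/
theorem eq_of_derivative_eq_mul {F G q : PowerSeries ℂ}
    (hF : PowerSeries.derivative ℂ F = F * q) (hG : PowerSeries.derivative ℂ G = G * q)
    (h0 : PowerSeries.coeff 0 F = PowerSeries.coeff 0 G) : F = G := by
  ext n
  induction n using Nat.strong_induction_on with
  | _ n ih =>
    cases n with
    | zero => exact h0
    | succ n =>
      have h1 := congrArg (PowerSeries.coeff n) hF
      have h2 := congrArg (PowerSeries.coeff n) hG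
      rw [PowerSeries.coeff_derivative, PowerSeries.coeff_mul] at h1 h2
      have h3 : (n : ℂ) + 1 ≠ 0 := by exact_mod_cast Nat.succ_ne_zero n
      refine mul_right_cancel₀ h3 ?_
      rw [h1, h2]
      refine Finset.sum_congr rfl fun p hp => ?_
      rw [ih p.1 (by have := Finset.HasAntidiagonal.mem_antidiagonal.mp hp; omega)]

theorem truncSeq_sum (d : ℕ) (f : ℕ → ℂ) (k : ℕ) :
    ((truncSeq d f).sum fun _ v => v ^ (k + 1)) = ∑ i ∈ Finset.range d, f i ^ (k + 1) := by
  rw [truncSeq, Finsupp.onFinset_sum _ (fun i => by simp)]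
  refine Finset.sum_congr rfl fun i hi => ?_
  rw [if_pos (Finset.mem_range.mp hi)]

theorem valueAt_X (a : ℤ → ℂ) (lam : YoungDiagram) {n : ℕ} (hn : length lam ≤ n) (k : ℕ) :
    valueAt a lam (MvPolynomial.X k) =
      ∑ i : Fin n, a (lam.rowLen i - i) ^ (k + 1) - ∑ i : Fin n, a (-(i : ℕ)) ^ (k + 1) := by
  rw [valueAt, superEval, MvPolynomial.aeval_X, xCoord, yCoord, truncSeq_sum, truncSeq_sum,
    ← Finset.sum_range fun i => a (lam.rowLen i - i) ^ (k + 1),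
    ← Finset.sum_range fun i : ℕ => a (-i) ^ (k + 1),
    ← sum_frob_eq_sum_rows lam hn fun m => a m ^ (k + 1), sub_eq_add_neg]
  congr 1
  rw [Finset.mul_sum, ← Finset.sum_neg_distrib]
  refine Finset.sum_congr rfl fun i _ => ?_
  -- The super sign `(-1)^k` and the sign of the dual sequence, `(-1)^(k+1)`, combine to `-1`.
  rw [dual, show 1 - (frobQ lam i + 1) = -frobQ lam i by ring, neg_pow (a (-frobQ lam i)),
    ← mul_assoc, ← pow_add, show k + (k + 1) = 2 * k + 1 by ring, pow_succ (-1 : ℂ), pow_mul]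
  simp

/-- The value of the generating series `H` at a diagram. -/
def valueSeries (a : ℤ → ℂ) (lam : YoungDiagram) : PowerSeries ℂ :=
  PowerSeries.mk fun n => valueAt a lam (h n)

/-- Both sides have the same logarithmic derivative, by Newton's identities and `valueAt_X`, and
constant term 1. -/
theorem valueSeries_mul_prod (a : ℤ → ℂ) (lam : YoungDiagram) {n : ℕ} (hn : length lam ≤ n) :
    valueSeries a lam *
        ∏ i : Fin n, (1 - PowerSeries.C (a (lam.rowLen i - i)) * PowerSeries.X) =
      ∏ i : Fin n, (1 - PowerSeries.C (a (-(i : ℕ))) * PowerSeries.X) := by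
  have hd : PowerSeries.derivative ℂ (valueSeries a lam) = valueSeries a lam *
      (∑ i : Fin n, PowerSeries.C (a (lam.rowLen i - i)) * geomSeries (a (lam.rowLen i - i)) -
        ∑ i : Fin n, PowerSeries.C (a (-(i : ℕ))) * geomSeries (a (-(i : ℕ)))) := by
    ext k
    have h1 := congrArg (valueAt a lam) (newton k)
    rw [PowerSeries.coeff_derivative, PowerSeries.coeff_mul, mul_comm]
    simp only [valueAt, map_mul, map_add, map_natCast, map_one, map_sum] at h1
    simp only [valueSeries, PowerSeries.coeff_mk]
    refine h1.trans (Finset.sum_congr rfl fun p _ => ?_)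
    congr 1
    refine (valueAt_X a lam hn p.2).trans ?_
    simp only [map_sub, map_sum, PowerSeries.coeff_C_mul, geomSeries, PowerSeries.coeff_mk,
      pow_succ']
  refine eq_of_derivative_eq_mul
    (q := -∑ i : Fin n, PowerSeries.C (a (-(i : ℕ))) * geomSeries (a (-(i : ℕ)))) ?_ ?_ ?_
  · rw [Derivation.leibniz, derivative_prod_one_sub, hd, smul_eq_mul, smul_eq_mul]
    ring
  · rw [derivative_prod_one_sub, mul_neg]
  · rw [PowerSeries.coeff_zero_eq_constantCoeff_apply,
      PowerSeries.coeff_zero_eq_constantCoeff_apply, map_mul, map_prod, map_prod]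
    simp only [valueSeries, ← PowerSeries.coeff_zero_eq_constantCoeff_apply,
      PowerSeries.coeff_mk]
    simp [valueAt, h, coeff_zero_H]

/-! ### Partial fractions -/

section PartialFractions

open Polynomial

theorem reflect_prod_X_sub_C {ι : Type*} (s : Finset ι) (b : ι → ℂ) :
    reflect s.card (∏ i ∈ s, (X - C (b i))) = ∏ i ∈ s, (1 - C (b i) * X) := by
  classical
  induction s using Finset.induction_on with
  | empty => simp
  | insert i s hi ih =>
    rw [Finset.prod_insert hi, Finset.prod_insert hi, Finset.card_insert_of_notMem hi, add_comm,
      reflect_mul _ _ (natDegree_X_sub_C_le _) (natDegree_finsetProd_X_sub_C_eq_card s b).le, ih]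
    simp [reflect_sub, reflect_C]

/-- Lagrange interpolation: the difference of two monic polynomials of degree `n` has degree less
than `n`, so its values at the `n` nodes determine it. -/
theorem prod_X_sub_C_eq_add_sum {n : ℕ} {z : Fin n → ℂ} (hinj : Function.Injective z)
    (b : Fin n → ℂ) :
    ∏ i, (X - C (b i)) = ∏ i, (X - C (z i)) +
      ∑ l, C ((∏ i, (z l - b i)) / ∏ j ∈ Finset.univ.erase l, (z l - z j)) *
        ∏ j ∈ Finset.univ.erase l, (X - C (z j)) := by
  have hcard : ∀ w : Fin n → ℂ, (∏ i, (X - C (w i))).degree = (n : WithBot ℕ) := fun w => by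
    rw [degree_eq_natDegree (monic_prod_X_sub_C w Finset.univ).ne_zero,
      natDegree_finsetProd_X_sub_C_eq_card, Finset.card_fin]
  refine Polynomial.eq_of_degree_sub_lt_of_eval_index_eq Finset.univ hinj.injOn ?_ fun i _ => ?_
  · rw [← mem_degreeLT, Finset.card_fin, ← sub_sub]
    refine sub_mem ?_ (sum_mem fun l _ => ?_)
    · rw [mem_degreeLT, ← hcard b]
      refine degree_sub_lt_left ((hcard b).trans (hcard z).symm)
        (monic_prod_X_sub_C b Finset.univ).ne_zero ?_
      rw [(monic_prod_X_sub_C b Finset.univ).leadingCoeff,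
        (monic_prod_X_sub_C z Finset.univ).leadingCoeff]
    · rw [← smul_eq_C_mul]
      refine Submodule.smul_mem _ _ ?_
      rw [mem_degreeLT, degree_eq_natDegree (monic_prod_X_sub_C z _).ne_zero,
        natDegree_finsetProd_X_sub_C_eq_card, Nat.cast_lt]
      exact (Finset.card_erase_lt_of_mem (Finset.mem_univ l)).trans_eq (Finset.card_fin n)
  · have h1 : ∏ j ∈ Finset.univ.erase i, (z i - z j) ≠ 0 :=
      Finset.prod_ne_zero_iff.mpr fun j hj =>
        sub_ne_zero.mpr fun h => Finset.ne_of_mem_erase hj (hinj h.symm)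
    simp only [eval_add, eval_prod, eval_finsetSum, eval_mul, eval_sub, eval_X, eval_C]
    rw [Finset.prod_eq_zero (f := fun j => z i - z j) (Finset.mem_univ i) (sub_self (z i)), zero_add,
      Finset.sum_eq_single i, div_mul_cancel₀ _ h1]
    · intro l _ hl
      rw [Finset.prod_eq_zero (f := fun j => z i - z j) (Finset.mem_erase.mpr ⟨hl.symm, Finset.mem_univ i⟩)
        (sub_self _), mul_zero]
    · exact fun h => absurd (Finset.mem_univ i) h

theorem prod_one_sub_eq_add_sum {n : ℕ} {z : Fin n → ℂ} (hinj : Function.Injective z)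
    (b : Fin n → ℂ) :
    ∏ i, (1 - PowerSeries.C (b i) * PowerSeries.X) =
      ∏ i, (1 - PowerSeries.C (z i) * PowerSeries.X) +
      ∑ l, PowerSeries.C ((∏ i, (z l - b i)) / ∏ j ∈ Finset.univ.erase l, (z l - z j)) *
        (PowerSeries.X *
          ∏ j ∈ Finset.univ.erase l, (1 - PowerSeries.C (z j) * PowerSeries.X)) := by
  have h1 := congrArg (reflect n) (prod_X_sub_C_eq_add_sum hinj b)
  have hsum : ∀ (s : Finset (Fin n)) (f : Fin n → ℂ[X]),
      reflect n (∑ l ∈ s, f l) = ∑ l ∈ s, reflect n (f l) := fun s f =>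
    map_sum (AddMonoidHom.mk' (reflect n) fun f g => reflect_add f g n) f s
  -- Reflection is the passage to `t = 1/u`; a product of only `n - 1` factors picks up an extra
  -- `t`.
  have herase : ∀ l : Fin n, reflect n (∏ j ∈ Finset.univ.erase l, (X - C (z j))) =
      X * ∏ j ∈ Finset.univ.erase l, (1 - C (z j) * X) := by
    intro l
    have hc : (Finset.univ.erase l).card + 1 = n := by
      rw [Finset.card_erase_add_one (Finset.mem_univ l), Finset.card_fin]
    have h2 := reflect_mul (∏ j ∈ Finset.univ.erase l, (X - C (z j))) 1
      (natDegree_finsetProd_X_sub_C_eq_card (Finset.univ.erase l) z).le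
      (natDegree_one.le.trans zero_le_one)
    rw [mul_one, hc, reflect_prod_X_sub_C, reflect_one, pow_one] at h2
    rw [h2, mul_comm]
  have huniv : ∀ b : Fin n → ℂ, reflect n (∏ i, (X - C (b i))) = ∏ i, (1 - C (b i) * X) := by
    intro b
    have := reflect_prod_X_sub_C Finset.univ b
    rwa [Finset.card_fin] at this
  rw [reflect_add, huniv, huniv, hsum] at h1
  simp only [reflect_C_mul, herase] at h1
  have h2 := congrArg (Polynomial.coeToPowerSeries.ringHom (R := ℂ)) h1
  rw [map_add, map_prod, map_prod, map_sum] at h2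
  simpa only [map_mul, map_prod, map_sub, map_one, coeToPowerSeries.ringHom_apply, coe_C,
    coe_X] using h2

end PartialFractions

theorem valueSeries_eq (a : ℤ → ℂ) (lam : YoungDiagram) {n : ℕ}
    (hn : length lam ≤ n) {z : Fin n → ℂ} (hz : ∀ l, z l = a (lam.rowLen l - (l : ℕ)))
    (hinj : Function.Injective z) :
    valueSeries a lam = 1 + ∑ l : Fin n,
      PowerSeries.C ((∏ i : Fin n, (z l - a (-(i : ℕ)))) /
        ∏ j ∈ Finset.univ.erase l, (z l - z j)) * (PowerSeries.X * geomSeries (z l)) := by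
  have hne : ∏ i : Fin n, (1 - PowerSeries.C (z i) * PowerSeries.X) ≠ 0 := by
    refine Finset.prod_ne_zero_iff.mpr fun i _ h => ?_
    have := one_sub_mul_geomSeries (z i)
    rw [h, zero_mul] at this
    exact zero_ne_one this
  refine mul_right_cancel₀ hne ?_
  have h1 := valueSeries_mul_prod a lam hn
  simp only [← hz] at h1
  rw [h1, prod_one_sub_eq_add_sum hinj, add_mul, one_mul, Finset.sum_mul]
  congr 1
  refine Finset.sum_congr rfl fun l _ => ?_
  rw [← Finset.mul_prod_erase Finset.univ
    (fun i => 1 - PowerSeries.C (z i) * PowerSeries.X) (Finset.mem_univ l)]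
  generalize (∏ i : Fin n, (z l - a (-(i : ℕ)))) / ∏ j ∈ Finset.univ.erase l, (z l - z j) = c
  linear_combination -(PowerSeries.C c * PowerSeries.X *
    ∏ j ∈ Finset.univ.erase l, (1 - PowerSeries.C (z j) * PowerSeries.X)) *
    one_sub_mul_geomSeries (z l)

/-! ### Values of the functions `h_{k;b}` -/

theorem basisSeries_succ (a : ℤ → ℂ) (k : ℕ) :
    basisSeries a (k + 1) * (1 - PowerSeries.C (a (k + 1)) * PowerSeries.X) =
      PowerSeries.X * basisSeries a k := by
  have h1 : PowerSeries.constantCoeff (1 - PowerSeries.C (a (k + 1)) * PowerSeries.X) ≠ 0 := by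
    simp
  rw [basisSeries, basisSeries, Finset.prod_range_succ, pow_succ', mul_assoc, mul_assoc,
    mul_assoc, PowerSeries.inv_mul_cancel _ h1, mul_one]

/-- The expansion of `1 / (u - z)` in the functions `1 / ((u - a_1) ⋯ (u - a_{k + 1}))`, with its
remainder term. -/
theorem sum_basisSeries_mul (a : ℤ → ℂ) (z : ℂ) (N : ℕ) :
    (∑ k ∈ Finset.range N, PowerSeries.C (∏ m ∈ Finset.range k, (z - a (m + 1))) *
        basisSeries a (k + 1)) * (1 - PowerSeries.C z * PowerSeries.X) =
      PowerSeries.X - PowerSeries.C (∏ m ∈ Finset.range N, (z - a (m + 1))) *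
        (PowerSeries.X * basisSeries a N) := by
  induction N with
  | zero => simp [basisSeries]
  | succ N ih =>
    rw [Finset.sum_range_succ, add_mul, ih, Finset.prod_range_succ, map_mul, map_sub]
    linear_combination PowerSeries.C (∏ m ∈ Finset.range N, (z - a (m + 1))) *
      basisSeries_succ a N

/-- The remainder after `N` terms starts in degree `N + 1`, so it does not affect the coefficient of
`t ^ N`. -/
theorem sum_coeff_basisSeries (a : ℤ → ℂ) (z : ℂ) (N : ℕ) :
    ∑ k ∈ Finset.range N, PowerSeries.coeff N (basisSeries a (k + 1)) *
        ∏ m ∈ Finset.range k, (z - a (m + 1)) =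
      PowerSeries.coeff N (PowerSeries.X * geomSeries z) := by
  have h1 : ∑ k ∈ Finset.range N, PowerSeries.C (∏ m ∈ Finset.range k, (z - a (m + 1))) *
        basisSeries a (k + 1) = PowerSeries.X * geomSeries z -
      PowerSeries.X * (PowerSeries.X ^ N * (
        PowerSeries.C (∏ m ∈ Finset.range N, (z - a (m + 1))) *
        (∏ i ∈ Finset.range N, (1 - PowerSeries.C (a ((i : ℤ) + 1)) * PowerSeries.X)⁻¹) *
        geomSeries z)) := by
    have h2 := sum_basisSeries_mul a z N
    rw [basisSeries] at h2
    linear_combination geomSeries z * h2 -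
      (∑ k ∈ Finset.range N, PowerSeries.C (∏ m ∈ Finset.range k, (z - a (m + 1))) *
        basisSeries a (k + 1)) * one_sub_mul_geomSeries z
  have h3 := congrArg (PowerSeries.coeff N) h1
  rw [← mul_assoc PowerSeries.X (PowerSeries.X ^ N), ← pow_succ', map_sub,
    PowerSeries.coeff_X_pow_mul', if_neg (by omega), sub_zero, map_sum] at h3
  rw [← h3]
  refine Finset.sum_congr rfl fun k _ => ?_
  rw [PowerSeries.coeff_C_mul, mul_comm]

/-- The values of the functions `h_{k;a}` are determined by the values of their generating
series. -/
theorem valueAt_hMulti_eq_of_sum_eq (a b : ℤ → ℂ) (lam : YoungDiagram) (w : ℕ → ℂ)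
    (hw : ∀ n, ∑ k ∈ Finset.range (n + 1), PowerSeries.coeff n (basisSeries b k) * w k =
      PowerSeries.coeff n (valueSeries a lam)) (n : ℕ) :
    valueAt a lam (hMulti b n) = w n := by
  induction n using Nat.strong_induction_on with
  | _ n ih =>
    have h1 := congrArg (valueAt a lam) (coeff_H_eq_sum b n)
    have h2 : valueAt a lam (PowerSeries.coeff n H) = PowerSeries.coeff n (valueSeries a lam) := by
      rw [valueSeries, PowerSeries.coeff_mk, h]
    rw [h2, ← hw n] at h1
    simp only [valueAt, map_sum, map_smul, smul_eq_mul] at h1 ih ⊢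
    have h3 := Finset.sum_congr rfl fun k (hk : k ∈ Finset.range n) =>
      congrArg (PowerSeries.coeff n (basisSeries b k) * ·) (ih k (Finset.mem_range.mp hk))
    rw [Finset.sum_range_succ, Finset.sum_range_succ, coeff_basisSeries_self, one_mul, one_mul,
      h3] at h1
    exact (add_left_cancel h1).symm

/-- The points `a_{λ_l - l}`, with the rows numbered from `0`. -/
def nodes (a : ℤ → ℂ) (lam : YoungDiagram) (n : ℕ) (l : Fin n) : ℂ := a (lam.rowLen l - (l : ℕ))

theorem nodes_injective {a : ℤ → ℂ} (ha : Function.Injective a) (lam : YoungDiagram) (n : ℕ) :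
    Function.Injective (nodes a lam n) := by
  intro i j hij
  have h1 := ha hij
  rcases lt_trichotomy (i : ℕ) j with hlt | heq | hlt
  · have := lam.rowLen_anti _ _ hlt.le
    omega
  · exact Fin.ext heq
  · have := lam.rowLen_anti _ _ hlt.le
    omega

theorem valueAt_hMulti_succ {a : ℤ → ℂ} (ha : Function.Injective a) (b : ℤ → ℂ)
    (lam : YoungDiagram) {n : ℕ} (hn : length lam ≤ n) (k : ℕ) :
    valueAt a lam (hMulti b (k + 1)) = ∑ l : Fin n,
      (∏ i : Fin n, (nodes a lam n l - a (-(i : ℕ)))) /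
        (∏ j ∈ Finset.univ.erase l, (nodes a lam n l - nodes a lam n j)) *
        ∏ m ∈ Finset.range k, (nodes a lam n l - b (m + 1)) := by
  refine valueAt_hMulti_eq_of_sum_eq a b lam (fun k => match k with
    | 0 => 1
    | k + 1 => ∑ l : Fin n, (∏ i : Fin n, (nodes a lam n l - a (-(i : ℕ)))) /
        (∏ j ∈ Finset.univ.erase l, (nodes a lam n l - nodes a lam n j)) *
        ∏ m ∈ Finset.range k, (nodes a lam n l - b (m + 1))) (fun N => ?_) (k + 1)
  rw [valueSeries_eq a lam hn (fun _ => rfl) (nodes_injective ha lam n), Finset.sum_range_succ',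
    map_add, map_sum, add_comm]
  congr 1
  · simp [basisSeries]
  · simp only [PowerSeries.coeff_C_mul, ← sum_coeff_basisSeries b, Finset.mul_sum]
    rw [Finset.sum_comm]
    refine Finset.sum_congr rfl fun l _ => Finset.sum_congr rfl fun m _ => ?_
    simp only [nodes]
    ring

/-! ### The values of `s_{μ;a}` as ratios of determinants -/

open Polynomial in
theorem sum_eval_div_eq_coeff {n : ℕ} {z : Fin n → ℂ} (hz : Function.Injective z) {P : ℂ[X]}
    (hP : P.natDegree < n) :
    ∑ l, P.eval (z l) / ∏ j ∈ Finset.univ.erase l, (z l - z j) = P.coeff (n - 1) := by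
  have h1 := Lagrange.coeff_eq_sum (s := Finset.univ) (v := z) hz.injOn (P := P)
    (by rw [Finset.card_fin]; exact degree_le_natDegree.trans_lt (by exact_mod_cast hP))
  rw [Finset.card_fin] at h1
  exact h1.symm

/-- The monic polynomial `∏_{m < r} (X - c_m)`. -/
def fallingPoly (c : ℕ → ℂ) (r : ℕ) : Polynomial ℂ :=
  ∏ m ∈ Finset.range r, (Polynomial.X - Polynomial.C (c m))

theorem fallingPoly_monic (c : ℕ → ℂ) (r : ℕ) : (fallingPoly c r).Monic :=
  Polynomial.monic_prod_X_sub_C c _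

theorem natDegree_fallingPoly (c : ℕ → ℂ) (r : ℕ) : (fallingPoly c r).natDegree = r := by
  rw [fallingPoly, Polynomial.natDegree_finsetProd_X_sub_C_eq_card, Finset.card_range]

theorem eval_fallingPoly (c : ℕ → ℂ) (r : ℕ) (x : ℂ) :
    (fallingPoly c r).eval x = ∏ m ∈ Finset.range r, (x - c m) := by
  simp [fallingPoly, Polynomial.eval_prod]

/-- The entries of the Jacobi--Trudi matrix of `s_{μ;a}` at a diagram. -/
theorem valueAt_entry {a : ℤ → ℂ} (ha : Function.Injective a) (lam : YoungDiagram) {n : ℕ}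
    (hn : length lam ≤ n) (j : Fin n) (r : ℕ) :
    valueAt a lam (extendByZero (hMulti (shift (-(j : ℤ)) a)) ((r : ℤ) + 1 - n + j)) =
      ∑ l, (fallingPoly (fun m => a (1 - n + m)) r).eval (nodes a lam n l) *
        (∏ j ∈ Finset.univ.erase l, (nodes a lam n l - nodes a lam n j))⁻¹ *
        (fallingPoly (fun m => a (-m)) j).eval (nodes a lam n l) := by
  have hinj := nodes_injective ha lam n
  have hpoly : ∀ P Q : Polynomial ℂ, ∑ l, P.eval (nodes a lam n l) *
        (∏ j ∈ Finset.univ.erase l, (nodes a lam n l - nodes a lam n j))⁻¹ *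
        Q.eval (nodes a lam n l) = ∑ l, (P * Q).eval (nodes a lam n l) /
          ∏ j ∈ Finset.univ.erase l, (nodes a lam n l - nodes a lam n j) := fun P Q =>
    Finset.sum_congr rfl fun l _ => by rw [Polynomial.eval_mul]; ring
  have hdeg : (fallingPoly (fun m => a (1 - n + m)) r *
      fallingPoly (fun m => a (-m)) j).natDegree = r + j := by
    rw [(fallingPoly_monic _ _).natDegree_mul (fallingPoly_monic _ _), natDegree_fallingPoly,
      natDegree_fallingPoly]
  have hj := j.isLt
  -- For `r + j < n` the sum is the coefficient of `X^(n-1)` in a monic polynomial of degree `r +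
  -- j`: 0 or 1, as required for `h` of negative or zero index. Positive indices use the partial
  -- fraction formula.
  rcases lt_trichotomy (r + j + 1) n with hlt | heq | hgt
  · rw [hpoly, sum_eval_div_eq_coeff hinj (by omega),
      Polynomial.coeff_eq_zero_of_natDegree_lt (by omega)]
    obtain ⟨m, hm⟩ : ∃ m, (r : ℤ) + 1 - n + j = Int.negSucc m := by
      cases hk : (r : ℤ) + 1 - n + j with
      | ofNat m => simp at hk; omega
      | negSucc m => exact ⟨m, rfl⟩
    rw [hm, extendByZero, valueAt, map_zero]
  · rw [hpoly, sum_eval_div_eq_coeff hinj (by omega), show n - 1 = r + j by omega, ← hdeg,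
      ((fallingPoly_monic _ _).mul (fallingPoly_monic _ _)).coeff_natDegree,
      show (r : ℤ) + 1 - n + j = Int.ofNat 0 by simp; omega, extendByZero, hMulti_zero, valueAt,
      map_one]
  · obtain ⟨k, hk⟩ : ∃ k, r + j = n + k := ⟨r + j - n, by omega⟩
    rw [show (r : ℤ) + 1 - n + j = Int.ofNat (k + 1) by simp; omega, extendByZero,
      valueAt_hMulti_succ ha _ lam hn]
    refine Finset.sum_congr rfl fun l _ => ?_
    rw [eval_fallingPoly, eval_fallingPoly]
    set x := nodes a lam n l
    -- The last `n - j` factors, read backwards, are the first `n - j` factors of the polynomial of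
    -- degree `r`; its other `k` factors are those of the shifted sequence.
    have h1 : ∏ i : Fin n, (x - a (-(i : ℕ))) = (∏ m ∈ Finset.range j, (x - a (-m))) *
        ∏ m ∈ Finset.range (n - j), (x - a (1 - n + m)) := by
      rw [← Finset.prod_range fun i : ℕ => x - a (-i),
        show Finset.range n = Finset.range (j + (n - j)) by rw [Nat.add_sub_cancel' hj.le],
        Finset.prod_range_add, ← Finset.prod_range_reflect (fun m : ℕ => x - a (-(j + m : ℕ)))]
      congr 1
      refine Finset.prod_congr rfl fun m hm => ?_
      have := Finset.mem_range.mp hm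
      congr 2
      omega
    have h2 : ∏ m ∈ Finset.range r, (x - a (1 - n + m)) =
        (∏ m ∈ Finset.range (n - j), (x - a (1 - n + m))) *
          ∏ m ∈ Finset.range k, (x - shift (-j) a (m + 1)) := by
      rw [show r = (n - j) + k by omega, Finset.prod_range_add]
      congr 1
      refine Finset.prod_congr rfl fun m _ => ?_
      rw [shift]
      congr 2
      omega
    rw [h1, h2]
    ring

/-- The matrix of values of the polynomials `(x - a_{1 - n}) (x - a_{2 - n}) ⋯` of degrees
`μ_i + n - 1 - i` at the nodes of a diagram. -/
def evalMatrix (a : ℤ → ℂ) (μ lam : YoungDiagram) (n : ℕ) : Matrix (Fin n) (Fin n) ℂ :=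
  Matrix.of fun i l =>
    (fallingPoly (fun m => a (1 - n + m)) (μ.rowLen i + n - 1 - i)).eval (nodes a lam n l)

/-- The roots in row `i` are the `a_m` with `1 - n ≤ m < μ_i - i`, and `λ_l - l ≥ 1 - n` since `l <
n`. -/
theorem evalMatrix_eq_zero (a : ℤ → ℂ) {μ lam : YoungDiagram} {n : ℕ} {i l : Fin n}
    (hil : (lam.rowLen l : ℤ) - (l : ℕ) < (μ.rowLen i : ℤ) - (i : ℕ)) :
    evalMatrix a μ lam n i l = 0 := by
  have hi := i.isLt
  have hl := l.isLt
  rw [evalMatrix, Matrix.of_apply, eval_fallingPoly]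
  refine Finset.prod_eq_zero (i := ((lam.rowLen l : ℤ) - (l : ℕ) - (1 - n)).toNat) ?_ ?_
  · rw [Finset.mem_range]
    omega
  · rw [nodes, sub_eq_zero]
    congr 1
    omega

theorem prod_inv_mul_prod_Ioi {n : ℕ} {z : Fin n → ℂ} (hz : Function.Injective z) :
    (∏ l, (∏ j ∈ Finset.univ.erase l, (z l - z j))⁻¹) *
      (∏ i, ∏ j ∈ Finset.Ioi i, (z j - z i)) = (∏ i, ∏ j ∈ Finset.Ioi i, (z i - z j))⁻¹ := by
  have hne : ∀ s : Fin n → Finset (Fin n), (∀ i, i ∉ s i) → ∏ i, ∏ j ∈ s i, (z i - z j) ≠ 0 :=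
    fun s hs => Finset.prod_ne_zero_iff.mpr fun i _ => Finset.prod_ne_zero_iff.mpr fun j hj =>
      sub_ne_zero.mpr fun h => hs i (by obtain rfl := hz h; exact hj)
  have h1 : ∏ l, ∏ j ∈ Finset.univ.erase l, (z l - z j) =
      (∏ i, ∏ j ∈ Finset.Ioi i, (z i - z j)) * ∏ i, ∏ j ∈ Finset.Iio i, (z i - z j) := by
    rw [← Finset.prod_mul_distrib]
    refine Finset.prod_congr rfl fun l _ => ?_
    rw [← Finset.prod_union (by
      rw [Finset.disjoint_left]
      intro j h h'
      exact lt_asymm (Finset.mem_Ioi.mp h) (Finset.mem_Iio.mp h'))]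
    refine Finset.prod_congr ?_ fun _ _ => rfl
    ext j
    simp only [Finset.mem_erase, Finset.mem_univ, and_true, Finset.mem_union, Finset.mem_Ioi,
      Finset.mem_Iio]
    rw [ne_iff_lt_or_gt, or_comm]
  have h2 : ∏ i, ∏ j ∈ Finset.Iio i, (z i - z j) = ∏ i, ∏ j ∈ Finset.Ioi i, (z j - z i) :=
    Finset.prod_comm' fun i j => by simp
  have h3 := hne (fun i => Finset.Iio i) fun i => by simp
  rw [Finset.prod_inv_distrib, h1, mul_inv, ← h2, mul_assoc, inv_mul_cancel₀ h3, mul_one]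

/-- The values of the multiparameter Schur functions as ratios of determinants. -/
theorem valueAt_multiSchur {a : ℤ → ℂ} (ha : Function.Injective a) (μ lam : YoungDiagram) {n : ℕ}
    (hμ : length μ ≤ n) (hlam : length lam ≤ n) :
    valueAt a lam (multiSchur a μ) = (evalMatrix a μ lam n).det *
      (∏ i, ∏ j ∈ Finset.Ioi i, (nodes a lam n i - nodes a lam n j))⁻¹ := by
  have hM : (superEval (xCoord a lam) (yCoord a lam)).mapMatrix
      (Matrix.of fun i j : Fin n =>
        extendByZero (hMulti (shift (-(j : ℤ)) a)) ((μ.rowLen i : ℤ) - (i : ℤ) + (j : ℤ))) =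
      evalMatrix a μ lam n * Matrix.diagonal (fun l =>
        (∏ j ∈ Finset.univ.erase l, (nodes a lam n l - nodes a lam n j))⁻¹) *
      Matrix.of fun l j : Fin n => (fallingPoly (fun m => a (-m)) j).eval (nodes a lam n l) := by
    ext i j
    rw [Matrix.mul_apply]
    simp only [Matrix.mul_diagonal]
    have h1 := valueAt_entry ha lam hlam j (μ.rowLen i + n - 1 - i)
    have hi := i.isLt
    rw [show ((μ.rowLen i + n - 1 - i : ℕ) : ℤ) + 1 - n + j = μ.rowLen i - (i : ℕ) + (j : ℕ) by
      omega] at h1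
    exact h1
  rw [← multiSchurDet_eq_multiSchur a μ hμ, multiSchurDet, valueAt, AlgHom.map_det, hM,
    Matrix.det_mul, Matrix.det_mul, Matrix.det_diagonal,
    ← Matrix.det_eval_matrixOfPolynomials_eq_det_vandermonde _ _
      (fun j => natDegree_fallingPoly _ _) (fun j => fallingPoly_monic _ _),
    Matrix.det_vandermonde, mul_assoc, prod_inv_mul_prod_Ioi (nodes_injective ha lam n)]

/-! ### Vanishing, and the value at `μ` itself -/

/-- A matrix with a zero block that meets the diagonal has determinant zero. -/
theorem det_eq_zero_of_block {n : ℕ} (A : Matrix (Fin n) (Fin n) ℂ) (k : Fin n)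
    (hA : ∀ i l, i ≤ k → k ≤ l → A i l = 0) : A.det = 0 := by
  rw [Matrix.det_apply]
  refine Finset.sum_eq_zero fun σ _ => ?_
  -- Otherwise `σ` would inject the `n - k` columns `l ≥ k` into the `n - k - 1` rows beyond `k`.
  obtain ⟨l, hkl, hl⟩ : ∃ l, k ≤ l ∧ σ l ≤ k := by
    by_contra! hcon
    have h1 := Finset.card_le_card_of_injOn (s := Finset.Ici k) (t := Finset.Ioi k) σ
      (fun l hl => Finset.mem_coe.mpr (Finset.mem_Ioi.mpr (hcon l (Finset.mem_Ici.mp hl))))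
      σ.injective.injOn
    rw [Fin.card_Ici, Fin.card_Ioi] at h1
    have := k.isLt
    omega
  rw [Finset.prod_eq_zero (f := fun i => A (σ i) i) (Finset.mem_univ l) (hA _ _ hl hkl), smul_zero]

/-- The vanishing theorem. -/
theorem valueAt_multiSchur_eq_zero {a : ℤ → ℂ} (ha : Function.Injective a) {μ lam : YoungDiagram}
    (h : ¬ μ ≤ lam) : valueAt a lam (multiSchur a μ) = 0 := by
  obtain ⟨k, hk⟩ := exists_rowLen_lt_of_not_le h
  have hkμ : k < length μ := by
    by_contra! hle
    rw [rowLen_eq_zero hle] at hk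
    omega
  rw [valueAt_multiSchur ha μ lam (le_max_left _ (length lam)) (le_max_right _ _),
    det_eq_zero_of_block _ ⟨k, hkμ.trans_le (le_max_left _ _)⟩, zero_mul]
  -- For `i ≤ k ≤ l`: `λ_l - l ≤ λ_k - k < μ_k - k ≤ μ_i - i`.
  intro i l hi hl
  refine evalMatrix_eq_zero a ?_
  have h1 := μ.rowLen_anti _ _ (Fin.le_def.mp hi)
  have h2 := lam.rowLen_anti _ _ (Fin.le_def.mp hl)
  have h3 := Fin.le_def.mp hi
  have h4 := Fin.le_def.mp hl
  simp only at h1 h2 h3 h4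
  omega

theorem valueAt_multiSchur_self {a : ℤ → ℂ} (ha : Function.Injective a) (μ : YoungDiagram) :
    valueAt a μ (multiSchur a μ) = hookProduct a μ := by
  have hdet : (evalMatrix a μ μ (length μ)).det = ∏ i, evalMatrix a μ μ (length μ) i i := by
    refine Matrix.det_of_isLowerTriangular _ fun i l hil => evalMatrix_eq_zero a ?_
    have h1 : (i : ℕ) < l := hil
    have h2 := μ.rowLen_anti _ _ h1.le
    omega
  have hdiag : ∀ i, evalMatrix a μ μ (length μ) i i =
      (∏ j ∈ Finset.Ioi i, (nodes a μ (length μ) i - nodes a μ (length μ) j)) *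
        ∏ j ∈ Finset.range (μ.rowLen i),
          (a ((μ.rowLen i : ℤ) - (i : ℕ)) - a ((j : ℤ) + 1 - (μ.colLen j : ℤ))) := by
    intro i
    rw [evalMatrix, Matrix.of_apply, eval_fallingPoly,
      prod_row_mul_prod_below μ le_rfl i.isLt fun m => nodes a μ (length μ) i - a m]
    congr 1
    refine Finset.prod_bij' (fun l hl => ⟨l, (Finset.mem_Ico.mp hl).2⟩) (fun l _ => l) ?_ ?_
      (fun _ _ => rfl) (fun _ _ => rfl) (fun _ _ => rfl)
    · intro l hl
      exact Finset.mem_Ioi.mpr (Fin.lt_def.mpr (Finset.mem_Ico.mp hl).1)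
    · intro l hl
      exact Finset.mem_Ico.mpr ⟨Fin.lt_def.mp (Finset.mem_Ioi.mp hl), l.isLt⟩
  have hne : ∏ i, ∏ j ∈ Finset.Ioi i, (nodes a μ (length μ) i - nodes a μ (length μ) j) ≠ 0 :=
    Finset.prod_ne_zero_iff.mpr fun i _ => Finset.prod_ne_zero_iff.mpr fun j hj =>
      sub_ne_zero.mpr fun h =>
        (Finset.mem_Ioi.mp hj).ne (nodes_injective ha μ _ h)
  rw [valueAt_multiSchur ha μ μ le_rfl le_rfl, hdet, Finset.prod_congr rfl fun i _ => hdiag i,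
    Finset.prod_mul_distrib, mul_right_comm, mul_inv_cancel₀ hne, one_mul, hookProduct,
    prod_cells μ le_rfl fun i j =>
      a ((μ.rowLen i : ℤ) - (i : ℕ)) - a ((j : ℤ) + 1 - (μ.colLen j : ℤ)), Finset.prod_range]

/-! ### Interpolation and uniqueness -/

/-- The exponent of the monomial `∏ 𝐩_{λ_i}` over the nonzero rows of `λ`. -/
def rowExponent (lam : YoungDiagram) : ℕ →₀ ℕ :=
  Multiset.toFinsupp ((lam.rowLens : Multiset ℕ).map (· - 1))

theorem sum_map_succ_toMultiset (m : ℕ →₀ ℕ) :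
    ((Finsupp.toMultiset m).map (· + 1)).sum = monomialDegree m := by
  induction m using Finsupp.induction_linear with
  | zero => simp [monomialDegree]
  | add m m' ih ih' =>
    rw [map_add, Multiset.map_add, Multiset.sum_add, ih, ih', monomialDegree_add]
  | single k c =>
    simp [monomialDegree, Finsupp.weight_single, weight, Multiset.map_nsmul, Multiset.sum_nsmul,
      -Multiset.sum_map_add]

theorem exists_rowExponent_eq (m : ℕ →₀ ℕ) :
    ∃ lam : YoungDiagram, rowExponent lam = m ∧ lam.card = monomialDegree m := by
  set w : List ℕ := ((Finsupp.toMultiset m).map (· + 1)).sort (· ≥ ·) with hwdef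
  have hw : w.SortedGE := (Multiset.pairwise_sort _ _).sortedGE
  have hcoe : (w : Multiset ℕ) = (Finsupp.toMultiset m).map (· + 1) := Multiset.sort_eq _ _
  have hpos : ∀ x ∈ w, 0 < x := by
    intro x hx
    rw [← Multiset.mem_coe, hcoe, Multiset.mem_map] at hx
    obtain ⟨y, -, rfl⟩ := hx
    omega
  have hlens := YoungDiagram.rowLens_ofRowLens_eq_self (hw := hw) hpos
  refine ⟨YoungDiagram.ofRowLens w hw, ?_, ?_⟩
  · rw [rowExponent, hlens, hcoe, Multiset.map_map]
    simp
  · have h1 : (YoungDiagram.ofRowLens w hw).card =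
        ((YoungDiagram.ofRowLens w hw).rowLens : Multiset ℕ).sum := by
      rw [card_eq_sum_rowLen _ le_rfl, YoungDiagram.rowLens, length, Multiset.sum_coe]
      rfl
    rw [h1, hlens, hcoe, sum_map_succ_toMultiset]

/-- The diagrams with at most `N` squares. -/
abbrev SmallDiagram (N : ℕ) : Type := {lam : YoungDiagram // lam.card ≤ N}

instance (N : ℕ) : Finite (SmallDiagram N) := by
  refine Finite.of_injective (β := Set.Iic (Finset.range N ×ˢ Finset.range N))
    (fun lam => ⟨lam.1.cells, ?_⟩) fun lam lam' h =>
      Subtype.ext (YoungDiagram.ext (congrArg Subtype.val h))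
  rintro ⟨i, j⟩ hc
  have h1 := YoungDiagram.mem_iff_lt_rowLen.mp ((lam.1.mem_cells _).mp hc)
  have h2 := YoungDiagram.mem_iff_lt_colLen.mp ((lam.1.mem_cells _).mp hc)
  have h3 : lam.1.rowLen i ≤ lam.1.card := by
    rw [YoungDiagram.rowLen_eq_card]
    exact Finset.card_le_card (Finset.filter_subset _ _)
  have h4 : lam.1.colLen j ≤ lam.1.card := by
    rw [YoungDiagram.colLen_eq_card]
    exact Finset.card_le_card (Finset.filter_subset _ _)
  have h5 := lam.2
  simp only [Finset.mem_product, Finset.mem_range]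
  omega

/-- Bounds the dimension by the number of diagrams; linear independence of the monomials is not
needed. -/
theorem eq_sum_monomial {N : ℕ} [Fintype (SmallDiagram N)] {F : SymFun}
    (hF : F ∈ degLT (N + 1)) : ∃ c : SmallDiagram N → ℂ,
      F = ∑ lam, c lam • MvPolynomial.monomial (rowExponent lam.1) (1 : ℂ) := by
  have hspan : F ∈ Submodule.span ℂ (Set.range fun lam : SmallDiagram N =>
      MvPolynomial.monomial (rowExponent lam.1) (1 : ℂ)) := by
    rw [F.as_sum]
    refine sum_mem fun m hm => ?_
    obtain ⟨lam, h1, h2⟩ := exists_rowExponent_eq m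
    have h3 := hF m (MvPolynomial.mem_support_iff.mp hm)
    rw [← mul_one (MvPolynomial.coeff m F), ← smul_eq_mul, ← MvPolynomial.smul_monomial]
    exact Submodule.smul_mem _ _ (Submodule.subset_span ⟨⟨lam, by omega⟩, by simp only [h1]⟩)
  obtain ⟨c, hc⟩ := (Submodule.mem_span_range_iff_exists_fun ℂ).mp hspan
  exact ⟨c, hc.symm⟩

/-- The values of a symmetric function at the diagrams with at most `N` squares. -/
def valueMap (a : ℤ → ℂ) (N : ℕ) : SymFun →ₗ[ℂ] (SmallDiagram N → ℂ) :=
  LinearMap.pi fun lam => (superEval (xCoord a lam.1) (yCoord a lam.1)).toLinearMap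

/-- Triangularity: every function on the diagrams with at most `N` squares is interpolated by a
symmetric function of degree at most `N`. -/
theorem exists_valueMap_eq {a : ℤ → ℂ} (ha : Function.Injective a) (N : ℕ)
    (v : SmallDiagram N → ℂ) : ∃ F ∈ degLT (N + 1), valueMap a N F = v := by
  classical
  have := Fintype.ofFinite (SmallDiagram N)
  -- Largest diagrams come first: apart from its value at `λ`, `s_{λ;a}` is supported on diagrams
  -- with more squares.
  suffices h : ∀ k, ∀ lam : SmallDiagram N, N - lam.1.card = k →
      Pi.single lam (1 : ℂ) ∈ (degLT (N + 1)).map (valueMap a N) by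
    have hv : v ∈ (degLT (N + 1)).map (valueMap a N) := by
      rw [pi_eq_sum_univ' v]
      refine sum_mem fun lam _ => Submodule.smul_mem _ _ ?_
      convert h _ lam rfl using 1
    exact hv
  intro k
  induction k using Nat.strong_induction_on with
  | _ k ih =>
    intro lam hlam
    have h1 : valueMap a N (multiSchur a lam.1) ∈ (degLT (N + 1)).map (valueMap a N) := by
      refine Submodule.mem_map_of_mem (degLT_mono ?_ (hasLeadingPart_multiSchur a _).mem_degLT_succ)
      have := lam.2
      omega
    have h2 : valueMap a N (multiSchur a lam.1) = hookProduct a lam.1 • Pi.single lam (1 : ℂ) +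
        ∑ ν ∈ Finset.univ.filter (fun ν : SmallDiagram N => lam.1.card < ν.1.card),
          valueAt a ν.1 (multiSchur a lam.1) • Pi.single ν (1 : ℂ) := by
      ext ν
      rw [Pi.add_apply, Finset.sum_apply]
      change valueAt a ν.1 (multiSchur a lam.1) = _
      simp only [Pi.smul_apply, Pi.single_apply, smul_eq_mul, mul_ite, mul_one, mul_zero]
      rw [Finset.sum_ite_eq]
      simp only [Finset.mem_filter, Finset.mem_univ, true_and]
      by_cases hν : ν = lam
      · subst hν
        simp [valueAt_multiSchur_self ha]
      · rw [if_neg hν, zero_add]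
        split_ifs with hlt
        · rfl
        · exact valueAt_multiSchur_eq_zero ha fun hle =>
            hν (Subtype.ext (eq_of_le_of_card_le hle (not_lt.mp hlt)))
    have h3 : ∑ ν ∈ Finset.univ.filter (fun ν : SmallDiagram N => lam.1.card < ν.1.card),
          valueAt a ν.1 (multiSchur a lam.1) • Pi.single ν (1 : ℂ) ∈
        (degLT (N + 1)).map (valueMap a N) := by
      refine sum_mem fun ν hν => Submodule.smul_mem _ _ (ih (N - ν.1.card) ?_ ν rfl)
      have := (Finset.mem_filter.mp hν).2
      have := ν.2
      omega
    rw [h2] at h1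
    exact (Submodule.smul_mem_iff _ (hookProduct_ne_zero ha lam.1)).mp
      ((Submodule.add_mem_iff_left _ h3).mp h1)

/-- A symmetric function of degree at most `N` that vanishes at all diagrams with at most `N`
squares is zero. -/
theorem eq_zero_of_valueAt_eq_zero {a : ℤ → ℂ} (ha : Function.Injective a) {N : ℕ} {F : SymFun}
    (hF : F ∈ degLT (N + 1)) (h0 : ∀ lam : YoungDiagram, lam.card ≤ N → valueAt a lam F = 0) :
    F = 0 := by
  have := Fintype.ofFinite (SmallDiagram N)
  let M : (SmallDiagram N → ℂ) →ₗ[ℂ] SymFun := Fintype.linearCombination ℂ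
    fun lam : SmallDiagram N => MvPolynomial.monomial (rowExponent lam.1) (1 : ℂ)
  have hM : ∀ G ∈ degLT (N + 1), ∃ c, M c = G := fun G hG => by
    obtain ⟨c, hc⟩ := eq_sum_monomial hG
    exact ⟨c, hc.symm⟩
  -- The composite is an endomorphism of a finite-dimensional space, so surjectivity implies
  -- injectivity.
  have hsurj : Function.Surjective ((valueMap a N).comp M) := fun v => by
    obtain ⟨G, hG, hGv⟩ := exists_valueMap_eq ha N v
    obtain ⟨c, rfl⟩ := hM G hG
    exact ⟨c, hGv⟩
  obtain ⟨c, rfl⟩ := hM F hF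
  have hc : (valueMap a N).comp M c = 0 := funext fun lam => h0 lam.1 lam.2
  rw [(map_eq_zero_iff _ (LinearMap.injective_iff_surjective.mpr hsurj)).mp hc, map_zero]

theorem eq_zero_of_mem_degLT {a : ℤ → ℂ} (ha : Function.Injective a) {d : ℕ} {F : SymFun}
    (hF : F ∈ degLT d) (h0 : ∀ lam : YoungDiagram, lam.card < d → valueAt a lam F = 0) :
    F = 0 := by
  cases d with
  | zero =>
    refine MvPolynomial.ext _ _ fun m => ?_
    by_contra hm
    have := hF m hm
    omega
  | succ d =>
    exact eq_zero_of_valueAt_eq_zero ha (by exact_mod_cast hF) fun lam hlam => h0 lam (by omega)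

theorem valueAt_sub (a : ℤ → ℂ) (lam : YoungDiagram) (F G : SymFun) :
    valueAt a lam (F - G) = valueAt a lam F - valueAt a lam G :=
  map_sub _ _ _

theorem valueAt_lowerDiagrams {a : ℤ → ℂ} (ha : Function.Injective a) (μ : YoungDiagram) :
    ∀ lam ∈ lowerDiagrams μ, valueAt a lam (multiSchur a μ) = 0 := fun _ hlam =>
  valueAt_multiSchur_eq_zero ha fun hle => hlam.2 (eq_of_le_of_card_le hle hlam.1)

/-- Specialize to `a_i = i`. If `s_μ` were 0, `s_{μ;a}` would have degree less than `|μ|` and vanish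
at all smaller diagrams, hence be 0, against its nonzero value at `μ`. -/
theorem schur_ne_zero (μ : YoungDiagram) : schur μ ≠ 0 := by
  intro h
  have ha : Function.Injective fun i : ℤ => (i : ℂ) := Int.cast_injective
  have h1 := (hasLeadingPart_multiSchur (fun i : ℤ => (i : ℂ)) μ).2
  rw [h, sub_zero] at h1
  have h2 := eq_zero_of_mem_degLT ha h1 fun lam hlam =>
    valueAt_lowerDiagrams ha μ lam ⟨hlam.le, fun heq => hlam.ne (by rw [heq])⟩
  refine hookProduct_ne_zero ha μ ?_
  rw [← valueAt_multiSchur_self ha, h2, valueAt, map_zero]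

end MultiSchur

end

theorem theorem5p5 (a : ℤ → ℂ) (ha : Function.Injective a) (μ : YoungDiagram) :
    (∀ F : MultiSchur.SymFun,
      (MultiSchur.topComponent F = MultiSchur.schur μ ∧
        ∀ lam ∈ MultiSchur.lowerDiagrams μ, MultiSchur.valueAt a lam F = 0) ↔
      F = MultiSchur.multiSchur a μ) ∧
    (∀ F : MultiSchur.SymFun,
      (MultiSchur.degree F ≤ μ.card ∧
        MultiSchur.valueAt a μ F = MultiSchur.hookProduct a μ ∧
        ∀ lam ∈ MultiSchur.lowerDiagrams μ, MultiSchur.valueAt a lam F = 0) ↔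
      F = MultiSchur.multiSchur a μ) := by
  have hlead := MultiSchur.hasLeadingPart_multiSchur a μ
  obtain ⟨hdeg, htop⟩ := hlead.topComponent_eq (MultiSchur.schur_ne_zero μ)
  have hvan := MultiSchur.valueAt_lowerDiagrams ha μ
  refine ⟨fun F => ⟨?_, ?_⟩, fun F => ⟨?_, ?_⟩⟩
  · rintro ⟨hF, h0⟩
    have hFlead := MultiSchur.hasLeadingPart_topComponent F
    -- The degree of `F` is not assumed; it is read off a monomial of the nonzero top component
    -- `s_μ`.
    have hFdeg : MultiSchur.degree F = μ.card := by
      obtain ⟨m, hm⟩ := MvPolynomial.ne_zero_iff.mp (MultiSchur.schur_ne_zero μ)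
      have h1 := hlead.1 m hm
      have h2 := hFlead.1 m (by rwa [hF])
      omega
    rw [hF, hFdeg] at hFlead
    rw [← sub_eq_zero]
    refine MultiSchur.eq_zero_of_mem_degLT ha (d := μ.card) ?_ fun lam hlam => ?_
    · rw [← sub_sub_sub_cancel_right F _ (MultiSchur.schur μ)]
      exact sub_mem hFlead.2 hlead.2
    · have hmem : lam ∈ MultiSchur.lowerDiagrams μ := ⟨hlam.le, fun h => hlam.ne (by rw [h])⟩
      rw [MultiSchur.valueAt_sub, h0 lam hmem, hvan lam hmem, sub_zero]
  · rintro rfl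
    exact ⟨htop, hvan⟩
  · rintro ⟨hF, hμ, h0⟩
    rw [← sub_eq_zero]
    refine MultiSchur.eq_zero_of_valueAt_eq_zero ha (N := μ.card)
      (sub_mem (MultiSchur.degree_le_iff.mp hF) hlead.mem_degLT_succ) fun lam hlam => ?_
    rw [MultiSchur.valueAt_sub]
    by_cases h : lam = μ
    · rw [h, hμ, MultiSchur.valueAt_multiSchur_self ha, sub_self]
    · rw [h0 lam ⟨hlam, h⟩, hvan lam ⟨hlam, h⟩, sub_zero]
  · rintro rfl
    exact ⟨hdeg.le, MultiSchur.valueAt_multiSchur_self ha μ, hvan⟩
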